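/- All graphs are finite, simple and unweighted (every edge has length $1$), and need not be connected; $d_G$ denotes the shortest-path distance of $G$, with value $\infty$ between different connected components. A graph $G=(V,E)$ is *chordal* if it has no induced cycle on four or more vertices. A partition $\mathcal P$ of $V$ is *$(\sigma,\tau,\Delta)$-scattering* for $G$ if every cluster $C\in\mathcal P$ induces a connected subgraph $G[C]$ and satisfies $d_G(u,v)\le\Delta$ for all $u,v\in C$, and the vertices of every shortest path of $G$ of length at most $\Delta/\sigma$ meet at most $\tau$ clusters of $\mathcal P$. For a set $K\subseteq V$ of terminals, a *solution to the Steiner Point Removal (SPR) problem with distortion $\alpha$* is an edge-weighted graph $M$ with vertex set $K$ that is a minor of $G$ in which every terminal lies in its own branch set (that is, there are pairwise disjoint sets $B_t\ni t$, $t\in K$, inducing connected subgraphs of $G$, such that for every edge $\{s,t\}$ of $M$ there is an edge of $G$ between $B_s$ and $B_t$), and whose weighted shortest-path distance $d_M$ satisfies $d_G(s,t)\le d_M(s,t)\le\alpha\, d_G(s,t)$ for all $s,t\in K$. Running times are counted on a random access machine with unit-cost addition and (truncated) subtraction of natural numbers; graphs are given by adjacency matrices. **Theorem.** (1) Every chordal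 graph is $(2,3)$-scatterable: for every chordal graph $G$ and every real $\Delta>0$ there is a $(2,3,\Delta)$-scattering partition of $G$, and there is one algorithm that computes such a partition from $G$ and $\lfloor\Delta\rfloor$ in time polynomial in the number of vertices of $G$. (2) Consequently there are a universal constant $\alpha$ and an algorithm that, given a chordal graph $G=(V,E)$ and a set $K\subseteq V$ of terminals, returns in time polynomial in $|V|$ a solution to the SPR problem for $(G,K)$ with distortion $\alpha$. -/

import Mathlib

open scoped NNReal ENNReal

/-! ### Graph notions -/

/-- A graph is chordal if none of its induced subgraphs is a cycle on four or more vertices. -/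
def SimpleGraph.IsChordal {V : Type*} (G : SimpleGraph V) : Prop :=
  ∀ k : ℕ, 4 ≤ k → ¬ (SimpleGraph.cycleGraph k).IsIndContained G

/-- `P` is a `(σ, τ, Δ)`-scattering partition of the unweighted graph `G`: a partition of the
vertex set into connected clusters of weak diameter at most `Δ` (distances are taken in `G`), such
that the vertices of every shortest path of length at most `Δ / σ` meet at most `τ` clusters. -/
structure SimpleGraph.IsScatteringPartition {V : Type*} (G : SimpleGraph V) (σ : ℝ) (τ : ℕ) (Δ : ℝ)
    (P : Set (Set V)) : Prop where
  isPartition : Setoid.IsPartition P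
  connected : ∀ C ∈ P, (G.induce C).Connected
  weakDiameter : ∀ C ∈ P, ∀ u ∈ C, ∀ v ∈ C, G.Reachable u v ∧ (G.dist u v : ℝ) ≤ Δ
  scattered : ∀ (u v : V) (p : G.Walk u v), p.length = G.dist u v → (p.length : ℝ) ≤ Δ / σ →
    {C ∈ P | ∃ x ∈ p.support, x ∈ C}.encard ≤ τ

/-- The shortest path distance of the graph `M` with edge weights `w` (`∞` between different
connected components). -/
noncomputable def SimpleGraph.weightedDist {V : Type*} (M : SimpleGraph V) (w : Sym2 V → ℝ≥0)
    (u v : V) : ℝ≥0∞ :=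
  ⨅ p : M.Walk u v, (((p.edges.map w).sum : ℝ≥0) : ℝ≥0∞)

/-- `B` is a minor model in `G` of the graph `M`, whose vertices are terminals of `G`: deleting the
vertices outside all sets `B t`, contracting each connected set `B t` to the terminal `t` that it
contains, and deleting edges, turns `G` into `M`. -/
structure SimpleGraph.IsTerminalMinorModel {V : Type*} (G : SimpleGraph V) {K : Set V}
    (M : SimpleGraph K) (B : K → Set V) : Prop where
  mem : ∀ t : K, (t : V) ∈ B t
  connected : ∀ t : K, (G.induce (B t)).Connected
  disjoint : ∀ s t : K, s ≠ t → Disjoint (B s) (B t)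
  adj : ∀ s t : K, M.Adj s t → ∃ x ∈ B s, ∃ y ∈ B t, G.Adj x y

/-- The graph `M` on the terminal set `K` with edge weights `w` is a solution of the Steiner point
removal problem for the unweighted graph `G` with distortion `α`. -/
structure SimpleGraph.IsSPRSolution {V : Type*} (G : SimpleGraph V) (K : Set V) (α : ℝ≥0)
    (M : SimpleGraph K) (w : Sym2 K → ℝ≥0) : Prop where
  minor : ∃ B : K → Set V, G.IsTerminalMinorModel M B
  lower : ∀ s t : K, (G.edist s t : ℝ≥0∞) ≤ M.weightedDist w s t
  upper : ∀ s t : K, M.weightedDist w s t ≤ α * (G.edist s t : ℝ≥0∞)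

/-! ### Random access programs with a step count

The memory consists of arrays of natural numbers; an array cell has two indices, which may be
computed at run time, while the name of the array is fixed in the program text. The arithmetic is
addition and truncated subtraction only (no multiplication), so that `T` steps at unit cost
lengthen the binary expansions of the numbers in memory by at most `O(T)` bits, and polynomial time
in this model is the usual polynomial time. -/

namespace RAM

/-- Contents of the memory: array name, first index, second index. -/
abbrev Store := ℕ → ℕ → ℕ → ℕ

inductive Expr : Type
  | lit (k : ℕ) : Expr
  | read (a : ℕ) (i j : Expr) : Expr
  | add (x y : Expr) : Expr
  | sub (x y : Expr) : Expr

def Expr.eval (s : Store) : Expr → ℕ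
  | .lit k => k
  | .read a i j => s a (i.eval s) (j.eval s)
  | .add x y => x.eval s + y.eval s
  | .sub x y => x.eval s - y.eval s

/-- The number of steps for evaluating an expression: one for each literal, memory access and
arithmetic operation. -/
def Expr.cost : Expr → ℕ
  | .lit _ => 1
  | .read _ i j => i.cost + j.cost + 1
  | .add x y => x.cost + y.cost + 1
  | .sub x y => x.cost + y.cost + 1

/-- Programs: no operation, assignment of `x` to the cell `(i, j)` of the array `a`, sequential
composition, branching on `x ≠ 0`, and the loop that repeats its body as long as `x ≠ 0`. -/
inductive Prog : Type
  | skip : Prog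
  | write (a : ℕ) (i j x : Expr) : Prog
  | seq (c d : Prog) : Prog
  | branch (x : Expr) (c d : Prog) : Prog
  | loop (x : Expr) (c : Prog) : Prog

/-- The store `s` with the cell `(i, j)` of the array `a` overwritten by `x`. -/
def Store.set (s : Store) (a i j x : ℕ) : Store :=
  fun a' i' j' => if a' = a ∧ i' = i ∧ j' = j then x else s a' i' j'

/-- `Exec c s t s'`: the program `c`, started with memory `s`, halts after exactly `t` steps with
memory `s'`. -/
inductive Exec : Prog → Store → ℕ → Store → Prop
  | skip (s : Store) : Exec .skip s 1 s
  | write (s : Store) (a : ℕ) (i j x : Expr) :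
      Exec (.write a i j x) s (i.cost + j.cost + x.cost + 1)
        (s.set a (i.eval s) (j.eval s) (x.eval s))
  | seq {c d : Prog} {s₁ s₂ s₃ : Store} {t₁ t₂ : ℕ} :
      Exec c s₁ t₁ s₂ → Exec d s₂ t₂ s₃ → Exec (.seq c d) s₁ (t₁ + t₂) s₃
  | branchThen {x : Expr} {c d : Prog} {s s' : Store} {t : ℕ} :
      x.eval s ≠ 0 → Exec c s t s' → Exec (.branch x c d) s (x.cost + t + 1) s'
  | branchElse {x : Expr} {c d : Prog} {s s' : Store} {t : ℕ} :
      x.eval s = 0 → Exec d s t s' → Exec (.branch x c d) s (x.cost + t + 1) s'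
  | loopStop {x : Expr} {c : Prog} {s : Store} :
      x.eval s = 0 → Exec (.loop x c) s (x.cost + 1) s
  | loopStep {x : Expr} {c : Prog} {s₁ s₂ s₃ : Store} {t₁ t₂ : ℕ} :
      x.eval s₁ ≠ 0 → Exec c s₁ t₁ s₂ → Exec (.loop x c) s₂ t₂ s₃ →
        Exec (.loop x c) s₁ (x.cost + t₁ + t₂ + 1) s₃

/-- The program `c`, started with memory `s`, halts within `T` steps, and its final memory
satisfies `Q`. -/
def HaltsWithin (c : Prog) (s : Store) (T : ℕ) (Q : Store → Prop) : Prop :=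
  ∃ t s', t ≤ T ∧ Exec c s t s' ∧ Q s'

open Classical in
/-- The initial memory for an input graph `G` whose vertices are numbered from `0` to `n - 1` by
`e`, together with a list `x` of further numbers: the adjacency matrix is in array `0`, the number
of vertices in cell `(0, 0)` of array `1`, the numbers `x` in column `0` of array `2`, and
everything else is `0`. -/
noncomputable def input {V : Type*} {n : ℕ} (e : V ≃ Fin n) (G : SimpleGraph V) (x : ℕ → ℕ) :
    Store
  | 0, i, j => if ∃ u v, G.Adj u v ∧ (e u : ℕ) = i ∧ (e v : ℕ) = j then 1 else 0
  | 1, 0, 0 => n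
  | 2, i, 0 => x i
  | _, _, _ => 0

open Classical in
/-- The indicator, in terms of the numbers of the vertices, of a set `K` of vertices. -/
noncomputable def indicator {V : Type*} {n : ℕ} (e : V ≃ Fin n) (K : Set V) (i : ℕ) : ℕ :=
  if ∃ v ∈ K, (e v : ℕ) = i then 1 else 0

/-- The partition of the vertex set described by the final memory: two vertices are in the same
cluster when their entries in column `0` of array `3` agree. -/
def outputPartition {V : Type*} {n : ℕ} (e : V ≃ Fin n) (s : Store) : Set (Set V) :=
  Set.range fun v : V => {u : V | s 3 (e u) 0 = s 3 (e v) 0}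

open Classical in
/-- The final memory holds, in the rows and columns of array `3` that belong to terminals, the
weighted adjacency matrix of the graph `M` with (positive) edge weights `w`, with entry `0` for
non-edges. -/
def OutputsGraph {V : Type*} {n : ℕ} (e : V ≃ Fin n) {K : Set V} (M : SimpleGraph K)
    (w : Sym2 K → ℕ) (s : Store) : Prop :=
  ∀ u v : K, s 3 (e u) (e v) = if M.Adj u v then w s(u, v) else 0

end RAM

/-! Layer the graph by the distance from a root chosen in each component. The graph side rests on
one consequence of chordality, `IsLayering.eq_or_adj_of_attached`: the vertices of layer `i - 1`
attached to one component of the layers from `i` on form a clique. Two distinct non-adjacent ones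
would be joined by a chordless path through the deeper layers and by another through the layers
nearer to the root, and these close up to a long induced cycle. Hence a component of a band of `w`
layers has weak diameter at most `2 * w + 1` (`dist_le_of_band`: climb to the clique, cross one
edge, descend), and the levels along a shortest path form a valley (`level_le_max`: a peak would
have a shortcut below it).

For scattering, the clusters are the components of bands of width `w = (⌊Δ⌋₊ - 1) / 2`. A shortest
path with at most `w + 1` edges is a valley: either it meets only two consecutive bands, leaving at
most one cluster of the upper band, crossing one of the lower band and entering one more of the
upper band, or it changes level at every edge and only its two ends leave the middle band.

For Steiner point removal one weighting of the edges combines bands of all widths. Let `D v` be one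
more than the distance from `v` to the terminals. An edge between different layers with its deeper
end in layer `l` is cut if the `D`-values of its ends sum to at most `16 * twoPart l`, so near `v`
the cuts are spaced in proportion to `D v`. A cut edge weighs this sum, any other edge weighs zero.
The uncut component of `v` stays within distance `D v` of it (`dist_le_of_reachable_freeGraph`), yet
a shortest path ending in a terminal collects weight at most `68` times its length
(`sum_detour_le`), because a piece of length about `D / 16` crosses at most one cut downwards and
one upwards. Contract the Voronoi cells of the terminals for this weight. A vertex `v` is within `69
* D v` of the terminal of its cell, and a shortest path changes cells only at cut edges, each paid
for by `70` times its weight; this gives the distortion `70 * 68 = 4760` (`isSPRSolution`).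

On the machine side, every table is given by a term whose only search is a bounded minimum. Such
terms are compiled once and for all together with a polynomial time bound (`haltsWithin_compile`,
`implements_tab`), and shortest paths come from `n` rounds of relaxation (`distances_spec`).
Throughout, `0` codes infinity, so finite distances are stored with one added. -/

namespace SimpleGraph

variable {V : Type*} {G : SimpleGraph V}

/-! ### Geodesics -/

/-- The vertices `q 0, …, q L` form a shortest path of `G`. -/
def IsGeodesic (G : SimpleGraph V) (q : ℕ → V) (L : ℕ) : Prop :=
  ∀ i j, i ≤ j → j ≤ L → G.edist (q i) (q j) = ((j - i : ℕ) : ℕ∞)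

/-- Each stretch of the walk bounds the distance of its ends from above; a strict inequality
anywhere would shorten the whole walk below the distance of its ends. -/
theorem Walk.isGeodesic_getVert {u v : V} (p : G.Walk u v) (hp : p.length = G.dist u v) :
    G.IsGeodesic p.getVert p.length := by
  intro i j hij hj
  have h1 : ∀ i j, i ≤ j → j ≤ p.length →
      G.edist (p.getVert i) (p.getVert j) ≤ ((j - i : ℕ) : ℕ∞) := by
    intro i j hij hj
    have := edist_le ((p.drop i).take (j - i))
    simp only [drop_getVert, take_length, drop_length] at this
    rw [Nat.add_sub_cancel' hij] at this
    refine this.trans ?_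
    exact_mod_cast min_le_left _ _
  refine le_antisymm (h1 i j hij hj) ?_
  have h0 : G.edist u v = (p.length : ℕ∞) := by
    rw [hp, Reachable.coe_dist_eq_edist p.reachable]
  have ht : G.edist u v ≤ ((i : ℕ) : ℕ∞) + G.edist (p.getVert i) (p.getVert j)
      + ((p.length - j : ℕ) : ℕ∞) := by
    calc G.edist u v ≤ G.edist u (p.getVert j) + G.edist (p.getVert j) v :=
          SimpleGraph.edist_triangle
      _ ≤ (G.edist u (p.getVert i) + G.edist (p.getVert i) (p.getVert j))
          + G.edist (p.getVert j) v := by gcongr; exact SimpleGraph.edist_triangle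
      _ ≤ _ := by
        gcongr
        · simpa using h1 0 i (Nat.zero_le _) (hij.trans hj)
        · simpa using h1 j p.length hj le_rfl
  rw [h0] at ht
  cases h : G.edist (p.getVert i) (p.getVert j) with
  | top => exact le_top
  | coe m =>
    rw [h] at ht
    norm_cast at ht ⊢
    omega

theorem IsGeodesic.adj_iff {q : ℕ → V} {L i j : ℕ} (h : G.IsGeodesic q L) (hij : i ≤ j)
    (hj : j ≤ L) : G.Adj (q i) (q j) ↔ j = i + 1 := by
  rw [← edist_eq_one_iff_adj, h i j hij hj]
  norm_cast
  omega

theorem IsGeodesic.eq_iff {q : ℕ → V} {L i j : ℕ} (h : G.IsGeodesic q L) (hij : i ≤ j)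
    (hj : j ≤ L) : q i = q j ↔ i = j := by
  rw [← edist_eq_zero_iff (G := G), h i j hij hj]
  norm_cast
  omega

theorem IsGeodesic.adj {q : ℕ → V} {L k : ℕ} (h : G.IsGeodesic q L) (hk : k < L) :
    G.Adj (q k) (q (k + 1)) :=
  (h.adj_iff (Nat.le_succ k) hk).2 rfl

theorem IsGeodesic.mono {q : ℕ → V} {L L' : ℕ} (h : G.IsGeodesic q L) (hL : L' ≤ L) :
    G.IsGeodesic q L' :=
  fun i j hij hj => h i j hij (hj.trans hL)

theorem IsGeodesic.shift {q : ℕ → V} {L a : ℕ} (h : G.IsGeodesic q L) (ha : a ≤ L) :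
    G.IsGeodesic (fun k => q (a + k)) (L - a) := by
  intro i j hij hj
  rw [h _ _ (by omega) (by omega)]
  congr 1
  omega

theorem IsGeodesic.reachable {q : ℕ → V} {L i j : ℕ} (h : G.IsGeodesic q L) (hij : i ≤ j)
    (hj : j ≤ L) : G.Reachable (q i) (q j) :=
  reachable_of_edist_ne_top (by rw [h i j hij hj]; exact ENat.natCast_ne_top _)

theorem IsGeodesic.dist_eq {q : ℕ → V} {L i j : ℕ} (h : G.IsGeodesic q L) (hij : i ≤ j)
    (hj : j ≤ L) : G.dist (q i) (q j) = j - i := by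
  have := Reachable.coe_dist_eq_edist (h.reachable hij hj)
  rw [h i j hij hj] at this
  exact_mod_cast this

theorem Reachable.exists_isGeodesic {x y : V} (h : G.Reachable x y) :
    ∃ q : ℕ → V, q 0 = x ∧ q (G.dist x y) = y ∧ G.IsGeodesic q (G.dist x y) := by
  obtain ⟨p, hp⟩ := h.exists_walk_length_eq_dist
  refine ⟨p.getVert, p.getVert_zero, ?_, ?_⟩
  · rw [← hp, p.getVert_length]
  · rw [← hp]; exact p.isGeodesic_getVert hp

/-! ### Clique separators in chordal graphs -/

/-- The graph on all of `V` whose edges are the edges of `G` inside `S`. -/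
def within (G : SimpleGraph V) (S : Set V) : SimpleGraph V where
  Adj u v := G.Adj u v ∧ u ∈ S ∧ v ∈ S
  symm := ⟨fun _ _ h => ⟨h.1.symm, h.2.2, h.2.1⟩⟩
  loopless := ⟨fun _ h => G.loopless.1 _ h.1⟩

theorem within_le (G : SimpleGraph V) (S : Set V) : G.within S ≤ G := fun _ _ h => h.1

theorem within_mono {S T : Set V} (h : S ⊆ T) : G.within S ≤ G.within T :=
  fun _ _ e => ⟨e.1, h e.2.1, h e.2.2⟩

theorem cycleGraph_adj_of_lt {n : ℕ} (hn : 3 ≤ n) {i j : Fin n} (hij : i < j) :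
    (cycleGraph n).Adj i j ↔ (j : ℕ) = i + 1 ∨ ((i : ℕ) = 0 ∧ (j : ℕ) + 1 = n) := by
  rw [cycleGraph_adj']
  have hi := i.2
  have hj := j.2
  have hlt : (i : ℕ) < j := hij
  have h1 : ((j - i : Fin n) : ℕ) = j - i := Fin.sub_val_of_le hij.le
  have h2 : ((i - j : Fin n) : ℕ) = n - j + i := by
    rw [Fin.sub_def]
    exact Nat.mod_eq_of_lt (by omega)
  rw [h1, h2]
  omega

/-- Shortest paths from `x` to `y` through the two sides are chordless, and no edge joins their
interiors. If `x` and `y` were distinct and non-adjacent, both would have length at least two and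
their union would be an induced cycle. -/
theorem IsChordal.eq_or_adj_of_separated (hG : G.IsChordal) {A B : Set V}
    (hAB : ∀ a ∈ A, ∀ b ∈ B, a ≠ b ∧ ¬ G.Adj a b) {x y : V}
    (hA : (G.within (A ∪ {x, y})).Reachable x y)
    (hB : (G.within (B ∪ {x, y})).Reachable x y) : x = y ∨ G.Adj x y := by
  by_contra hxy
  push Not at hxy
  obtain ⟨hne, hnadj⟩ := hxy
  have key : ∀ S : Set V, (G.within (S ∪ {x, y})).Reachable x y → ∃ (p : ℕ → V) (a : ℕ),
      2 ≤ a ∧ p 0 = x ∧ p a = y ∧ (∀ i, 0 < i → i < a → p i ∈ S) ∧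
      (∀ i j, i < j → j ≤ a → p i ≠ p j ∧ (G.Adj (p i) (p j) ↔ j = i + 1)) := by
    intro S hS
    obtain ⟨p, h0, ha, hp⟩ := hS.exists_isGeodesic
    set a := (G.within (S ∪ {x, y})).dist x y with ha_def
    have hmem : ∀ i, i ≤ a → p i ∈ S ∪ {x, y} := by
      intro i hi
      rcases hi.eq_or_lt with rfl | hi
      · rw [ha]; simp
      · exact (hp.adj hi).2.1
    refine ⟨p, a, ?_, h0, ha, ?_, ?_⟩
    · by_contra hlt
      have : a = 0 ∨ a = 1 := by omega
      rcases this with h | h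
      · rw [h] at ha; exact hne (h0.symm.trans ha)
      · have := (hp.adj (k := 0) (by omega)).1
        rw [h] at ha
        rw [h0, zero_add, ha] at this
        exact hnadj this
    · intro i hi hia
      rcases hmem i hia.le with h | h | h
      · exact h
      · rw [← h0, eq_comm, hp.eq_iff hi.le hia.le] at h; omega
      · rw [Set.mem_singleton_iff, ← ha, hp.eq_iff hia.le le_rfl] at h; omega
    · intro i j hij hj
      refine ⟨fun h => ?_, ?_⟩
      · rw [hp.eq_iff hij.le hj] at h; omega
      · rw [← hp.adj_iff hij.le hj]
        exact ⟨fun h => ⟨h, hmem _ (by omega), hmem _ hj⟩, fun h => h.1⟩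
  obtain ⟨p, a, ha2, hp0, hpa, hpA, hp⟩ := key A hA
  obtain ⟨q, b, hb2, hq0, hqb, hqB, hq⟩ := key B hB
  -- Along `p` from `x` to `y`, then back along `q`: the index `a + b - k` runs from `b - 1` down to
  -- `1`, so `x` and `y` occur only once.
  let c : Fin (a + b) → V := fun k => if (k : ℕ) ≤ a then p k else q (a + b - k)
  have hc : ∀ i j : Fin (a + b), i < j →
      c i ≠ c j ∧ (G.Adj (c i) (c j) ↔ (cycleGraph (a + b)).Adj i j) := by
    intro i j hij
    rw [cycleGraph_adj_of_lt (by omega) hij]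
    have hlt : (i : ℕ) < j := hij
    have hj := j.2
    by_cases hja : (j : ℕ) ≤ a
    · have hia : (i : ℕ) ≤ a := by omega
      simp only [c, hja, hia, if_true]
      refine ⟨(hp i j hlt hja).1, ?_⟩
      rw [(hp i j hlt hja).2]
      omega
    · by_cases hia : (i : ℕ) ≤ a
      · simp only [c, hja, hia, if_true, if_false]
        have hjB : q (a + b - j) ∈ B := hqB _ (by omega) (by omega)
        by_cases hi0 : (i : ℕ) = 0
        · rw [hi0, hp0, ← hq0]
          have := hq 0 (a + b - j) (by omega) (by omega)
          refine ⟨this.1, ?_⟩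
          rw [this.2]
          omega
        · by_cases hia' : (i : ℕ) = a
          · rw [hia', hpa, ← hqb]
            have := hq (a + b - j) b (by omega) le_rfl
            refine ⟨this.1.symm, ?_⟩
            rw [G.adj_comm, this.2]
            omega
          · have hiA : p i ∈ A := hpA _ (by omega) (by omega)
            refine ⟨(hAB _ hiA _ hjB).1, ?_⟩
            have := (hAB _ hiA _ hjB).2
            simp only [this, false_iff]
            omega
      · simp only [c, hja, hia, if_false]
        have := hq (a + b - j) (a + b - i) (by omega) (by omega)
        refine ⟨this.1.symm, ?_⟩
        rw [G.adj_comm, this.2]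
        omega
  refine hG (a + b) (by omega) ⟨⟨⟨c, ?_⟩, ?_⟩⟩
  · intro i j hij
    rcases lt_trichotomy i j with h | h | h
    · exact ((hc i j h).1 hij).elim
    · exact h
    · exact ((hc j i h).1 hij.symm).elim
  · intro i j
    change G.Adj (c i) (c j) ↔ _
    rcases lt_trichotomy i j with h | h | h
    · exact (hc i j h).2
    · subst h; simp
    · rw [G.adj_comm, (hc j i h).2, adj_comm]

/-! ### Breadth-first layerings -/

/-- `level` is the distance from the root `r v` chosen in the connected component of `v`. -/
structure IsLayering (G : SimpleGraph V) (r : V → V) (level : V → ℕ) : Prop where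
  reachable : ∀ v, G.Reachable (r v) v
  root_eq : ∀ u v, G.Reachable u v → r u = r v
  level_eq : ∀ v, level v = G.dist (r v) v

namespace IsLayering

variable {r : V → V} {level : V → ℕ}

theorem level_le (h : G.IsLayering r level) {u v : V} (huv : G.Reachable u v) :
    level v ≤ level u + G.dist u v := by
  rw [h.level_eq, h.level_eq, ← h.root_eq u v huv]
  exact huv.dist_triangle_right _

theorem level_le_of_adj (h : G.IsLayering r level) {u v : V} (huv : G.Adj u v) :
    level v ≤ level u + 1 := by
  have := h.level_le huv.reachable
  rwa [dist_eq_one_iff_adj.2 huv] at this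

theorem exists_parent (h : G.IsLayering r level) {v : V} (hv : level v ≠ 0) :
    ∃ u, G.Adj u v ∧ level u + 1 = level v := by
  obtain ⟨q, h0, h1, hq⟩ := (h.reachable v).exists_isGeodesic
  rw [← h.level_eq] at h1 hq
  have hadj := hq.adj (k := level v - 1) (by omega)
  rw [show level v - 1 + 1 = level v by omega, h1] at hadj
  refine ⟨_, hadj, ?_⟩
  rw [h.level_eq (q _), h.root_eq _ _ hadj.reachable, ← h0,
    hq.dist_eq (Nat.zero_le _) (by omega)]
  omega

theorem exists_ancestor (h : G.IsLayering r level) {v : V} {j : ℕ} (hj : j ≤ level v) :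
    ∃ u, level u = j ∧ (G.within {w | j ≤ level w}).Reachable u v ∧
      G.dist u v ≤ level v - j := by
  obtain ⟨k, hk⟩ := Nat.exists_eq_add_of_le hj
  induction k generalizing v with
  | zero => exact ⟨v, by omega, Reachable.refl _, by simp⟩
  | succ k ih =>
    obtain ⟨w, hwv, hw⟩ := h.exists_parent (v := v) (by omega)
    obtain ⟨u, hu, hr, hd⟩ := ih (v := w) (by omega) (by omega)
    have hadj : (G.within {w | j ≤ level w}).Adj w v := ⟨hwv, by simp; omega, by simp; omega⟩
    refine ⟨u, hu, hr.trans hadj.reachable, ?_⟩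
    have := hwv.reachable.dist_triangle_right u
    rw [dist_eq_one_iff_adj.2 hwv] at this
    omega

/-- In a chordal graph, the neighbours, in the layer above, of a component of the union of the
layers from `i` on are pairwise adjacent. -/
theorem eq_or_adj_of_attached (h : G.IsLayering r level) (hG : G.IsChordal) {i : ℕ} {x y u v : V}
    (hx : level x < i) (hy : level y < i) (hu : i ≤ level u)
    (hxu : G.Adj x u) (hyv : G.Adj y v)
    (huv : (G.within {w | i ≤ level w}).Reachable u v) (hv : i ≤ level v) : x = y ∨ G.Adj x y := by
  have hxi := h.level_le_of_adj hxu
  have hyi := h.level_le_of_adj hyv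
  have hxy : G.Reachable x y := hxu.reachable.trans ((huv.mono (within_le _ _)).trans
    hyv.symm.reachable)
  have hA : (G.within ({w | i ≤ level w} ∪ {x, y})).Reachable x y := by
    have e1 : (G.within ({w | i ≤ level w} ∪ {x, y})).Adj x u :=
      ⟨hxu, by simp, Or.inl hu⟩
    have e2 : (G.within ({w | i ≤ level w} ∪ {x, y})).Adj v y :=
      ⟨hyv.symm, Or.inl hv, by simp⟩
    exact e1.reachable.trans ((huv.mono (within_mono Set.subset_union_left)).trans e2.reachable)
  -- Both `x` and `y` lie in layer `i - 1`. If this is layer `0`, they are the same root; otherwise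
  -- the second path of the separation argument passes through their common root.
  rcases Nat.eq_zero_or_pos (level x) with h0 | h0
  · have h1 : level y = 0 := by omega
    rw [h.level_eq, (h.reachable _).dist_eq_zero_iff] at h0 h1
    left
    rw [← h0, ← h1, h.root_eq x y hxy]
  · have hlt : ∀ z, level z + 1 < i → ∃ s, (G.within ({w | level w + 1 < i} ∪ {x, y})).Reachable s z
        ∧ level s = 0 := by
      intro z hz
      induction hk : level z generalizing z with
      | zero => exact ⟨z, Reachable.refl _, hk⟩
      | succ k ih =>
        obtain ⟨w, hwz, hw⟩ := h.exists_parent (v := z) (by omega)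
        obtain ⟨s, hs, hs0⟩ := ih w (by omega) (by omega)
        refine ⟨s, hs.trans (Adj.reachable ⟨hwz, Or.inl ?_, Or.inl hz⟩), hs0⟩
        simp; omega
    have hroot : ∀ z, z ∈ ({x, y} : Set V) → 0 < level z → level z < i →
        (G.within ({w | level w + 1 < i} ∪ {x, y})).Reachable (r z) z := by
      intro z hzm hz0 hzi
      obtain ⟨w, hwz, hw⟩ := h.exists_parent (v := z) (by omega)
      obtain ⟨s, hs, hs0⟩ := hlt w (by omega)
      have e : (G.within ({w | level w + 1 < i} ∪ {x, y})).Adj w z :=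
        ⟨hwz, Or.inl (by simp; omega), Or.inr hzm⟩
      have hsz := hs.trans e.reachable
      rw [h.level_eq, (h.reachable _).dist_eq_zero_iff] at hs0
      rw [← h.root_eq _ _ (hsz.mono (within_le _ _)), hs0]
      exact hsz
    refine hG.eq_or_adj_of_separated (A := {w | i ≤ level w}) (B := {w | level w + 1 < i}) ?_ hA ?_
    · intro a ha b hb
      simp only [Set.mem_ofPred_eq] at ha hb
      refine ⟨fun hab => by subst hab; omega, fun hab => ?_⟩
      have := h.level_le_of_adj hab.symm
      omega
    · have h1 := hroot x (by simp) h0 hx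
      have h2 := hroot y (by simp) (by omega) hy
      rw [← h.root_eq x y hxy] at h2
      exact h1.symm.trans h2

/-- A component of the union of `w` consecutive layers has weak diameter at most `2 * w + 1`. -/
theorem dist_le_of_band (h : G.IsLayering r level) (hG : G.IsChordal) {i w : ℕ} {u v : V}
    (huv : (G.within {z | i ≤ level z}).Reachable u v) (hu : i ≤ level u) (hv : i ≤ level v)
    (hu' : level u < i + w) (hv' : level v < i + w) : G.dist u v ≤ 2 * w + 1 := by
  have tri : ∀ {a b : V} (c : V), G.Reachable a b → G.dist a c ≤ G.dist a b + G.dist b c :=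
    fun c hab => hab.dist_triangle_left c
  rcases Nat.eq_zero_or_pos i with rfl | hi
  · have h1 := (h.reachable u).symm
    have := tri v h1
    rw [dist_comm (v := r u), ← h.level_eq, h.root_eq u v (huv.mono (within_le _ _)),
      ← h.level_eq] at this
    omega
  -- On each side at most `w - 1` steps lead to layer `i` and one more to layer `i - 1`, where at
  -- most one edge of the clique remains: `2 * w + 1` in total.
  · obtain ⟨u', hu'l, hru, hdu⟩ := h.exists_ancestor hu
    obtain ⟨v', hv'l, hrv, hdv⟩ := h.exists_ancestor hv
    obtain ⟨x, hxu, hx⟩ := h.exists_parent (v := u') (by omega)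
    obtain ⟨y, hyv, hy⟩ := h.exists_parent (v := v') (by omega)
    have hxy : G.dist x y ≤ 1 ∧ G.Reachable x y := by
      rcases h.eq_or_adj_of_attached hG (i := i) (by omega) (by omega) hu'l.ge hxu hyv
        (hru.trans (huv.trans hrv.symm)) hv'l.ge with rfl | hadj
      · simp
      · exact ⟨(dist_eq_one_iff_adj.2 hadj).le, hadj.reachable⟩
    have r1 := (hru.mono (within_le _ _)).symm
    have r2 := hrv.mono (within_le _ _)
    have t1 := tri v r1
    have t2 := tri v hxu.symm.reachable
    have t3 := tri v hxy.2
    have t4 := tri v hyv.reachable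
    rw [dist_comm (u := u) (v := u')] at t1
    rw [dist_eq_one_iff_adj.2 hxu.symm] at t2
    rw [dist_eq_one_iff_adj.2 hyv] at t4
    omega

/-- Along a shortest path of a chordal graph the levels first decrease and then increase. -/
theorem level_le_max (h : G.IsLayering r level) (hG : G.IsChordal) {q : ℕ → V} {L : ℕ}
    (hq : G.IsGeodesic q L) {a b c : ℕ} (hab : a ≤ b) (hbc : b ≤ c) (hc : c ≤ L) :
    level (q b) ≤ max (level (q a)) (level (q c)) := by
  by_contra hlt
  have hlt' : level (q a) < level (q b) ∧ level (q c) < level (q b) := by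
    simpa using hlt
  set i := level (q b) with hi
  have hleft : ∀ k, k ≤ b - a → (∀ j, j < k → i ≤ level (q (b - j))) →
      (G.within {z | i ≤ level z}).Reachable (q b) (q (b - (k - 1))) := by
    intro k hk hall
    induction k with
    | zero => exact Reachable.refl _
    | succ k ih =>
      rcases Nat.eq_zero_or_pos k with rfl | hk0
      · exact Reachable.refl _
      · have h1 := ih (by omega) (fun j hj => hall j (by omega))
        have h2 : (G.within {z | i ≤ level z}).Adj (q (b - (k - 1))) (q (b - k)) := by
          refine ⟨?_, hall (k - 1) (by omega), hall k (by omega)⟩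
          have := hq.adj (k := b - k) (by omega)
          rw [show b - k + 1 = b - (k - 1) by omega] at this
          exact this.symm
        exact h1.trans h2.reachable
  have hright : ∀ k, k ≤ c - b → (∀ j, j < k → i ≤ level (q (b + j))) →
      (G.within {z | i ≤ level z}).Reachable (q b) (q (b + (k - 1))) := by
    intro k hk hall
    induction k with
    | zero => exact Reachable.refl _
    | succ k ih =>
      rcases Nat.eq_zero_or_pos k with rfl | hk0
      · exact Reachable.refl _
      · have h1 := ih (by omega) (fun j hj => hall j (by omega))
        have h2 : (G.within {z | i ≤ level z}).Adj (q (b + (k - 1))) (q (b + k)) := by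
          refine ⟨?_, hall (k - 1) (by omega), hall k (by omega)⟩
          have := hq.adj (k := b + (k - 1)) (by omega)
          rwa [show b + (k - 1) + 1 = b + k by omega] at this
        exact h1.trans h2.reachable
  -- Take the first vertices below level `i` on either side of `b`. They are attached to the same
  -- component of the layers from `i` on, hence equal or adjacent, although they are at least two
  -- apart on the shortest path.
  have ex1 : ∃ k, level (q (b - k)) < i := ⟨b - a, by
    rw [show b - (b - a) = a by omega]; exact hlt'.1⟩
  have ex2 : ∃ k, level (q (b + k)) < i := ⟨c - b, by
    rw [show b + (c - b) = c by omega]; exact hlt'.2⟩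
  classical
  set k1 := Nat.find ex1 with hk1
  set k2 := Nat.find ex2 with hk2
  have s1 : level (q (b - k1)) < i := Nat.find_spec ex1
  have s2 : level (q (b + k2)) < i := Nat.find_spec ex2
  have m1 : ∀ j, j < k1 → i ≤ level (q (b - j)) := fun j hj => not_lt.1 (Nat.find_min ex1 hj)
  have m2 : ∀ j, j < k2 → i ≤ level (q (b + j)) := fun j hj => not_lt.1 (Nat.find_min ex2 hj)
  have b1 : k1 ≤ b - a := Nat.find_min' ex1 (by
    rw [show b - (b - a) = a by omega]; exact hlt'.1)
  have b2 : k2 ≤ c - b := Nat.find_min' ex2 (by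
    rw [show b + (c - b) = c by omega]; exact hlt'.2)
  have p1 : k1 ≠ 0 := by
    intro h0; rw [h0] at s1; simp [hi] at s1
  have p2 : k2 ≠ 0 := by
    intro h0; rw [h0] at s2; simp [hi] at s2
  have r1 := hleft k1 b1 m1
  have r2 := hright k2 b2 m2
  have a1 := hq.adj (k := b - k1) (by omega)
  rw [show b - k1 + 1 = b - (k1 - 1) by omega] at a1
  have a2 := hq.adj (k := b + (k2 - 1)) (by omega)
  rw [show b + (k2 - 1) + 1 = b + k2 by omega] at a2
  rcases h.eq_or_adj_of_attached hG s1 s2 (m1 (k1 - 1) (by omega)) a1 a2.symm (r1.symm.trans r2)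
    (m2 (k2 - 1) (by omega)) with heq | hadj
  · rw [hq.eq_iff (by omega) (by omega)] at heq; omega
  · rw [hq.adj_iff (by omega) (by omega)] at hadj; omega

end IsLayering

end SimpleGraph

namespace SimpleGraph

variable {V : Type*} {G : SimpleGraph V}

/-! ### Scattering partitions of chordal graphs -/

/-- The edges of `G` inside the bands of `w` consecutive layers; no edges if `w = 0`. -/
def bandGraph (G : SimpleGraph V) (level : V → ℕ) (w : ℕ) : SimpleGraph V where
  Adj u v := G.Adj u v ∧ w ≠ 0 ∧ level u / w = level v / w
  symm := ⟨fun _ _ h => ⟨h.1.symm, h.2.1, h.2.2.symm⟩⟩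
  loopless := ⟨fun _ h => G.loopless.1 _ h.1⟩

theorem bandGraph_le (level : V → ℕ) (w : ℕ) : G.bandGraph level w ≤ G := fun _ _ h => h.1

theorem isPartition_range_reachable (H : SimpleGraph V) :
    Setoid.IsPartition (Set.range fun v : V => {u : V | H.Reachable u v}) := by
  refine ⟨?_, fun a => ⟨{u | H.Reachable u a}, ⟨⟨a, rfl⟩, Reachable.refl a⟩, ?_⟩⟩
  · rintro ⟨v, hv⟩
    have : v ∈ {u | H.Reachable u v} := Reachable.refl v
    simp only at hv
    rw [hv] at this
    exact this
  · rintro _ ⟨⟨v, rfl⟩, hv⟩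
    have hv' : H.Reachable a v := hv
    ext u
    exact ⟨fun h => h.trans hv'.symm, fun h => h.trans hv'⟩

theorem induce_connected_of_walks {S : Set V} {x : V} (hx : x ∈ S)
    (h : ∀ v ∈ S, ∃ p : G.Walk x v, ∀ y ∈ p.support, y ∈ S) : (G.induce S).Connected := by
  have : Nonempty S := ⟨⟨x, hx⟩⟩
  refine ⟨fun u v => ?_⟩
  obtain ⟨p, hp⟩ := h u u.2
  obtain ⟨q, hq⟩ := h v v.2
  exact ((p.induce S hp).reachable.symm).trans (q.induce S hq).reachable

theorem induce_setOf_reachable_connected {H : SimpleGraph V} (hH : H ≤ G) (v : V) :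
    (G.induce {u | H.Reachable u v}).Connected := by
  refine induce_connected_of_walks (x := v) (Reachable.refl v) fun u hu => ?_
  obtain ⟨p⟩ := Reachable.symm (show H.Reachable u v from hu)
  refine ⟨p.mapLe hH, fun y hy => ?_⟩
  rw [Walk.support_mapLe_eq_support] at hy
  classical
  exact (p.takeUntil y hy).reachable.symm

theorem reachable_bandGraph {level : V → ℕ} {w : ℕ} {q : ℕ → V} {L : ℕ} (hq : G.IsGeodesic q L)
    (hw : w ≠ 0) {c a b : ℕ} (hab : a ≤ b) (hb : b ≤ L)
    (hc : ∀ k, a ≤ k → k ≤ b → level (q k) / w = c) :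
    (G.bandGraph level w).Reachable (q a) (q b) := by
  induction b, hab using Nat.le_induction with
  | base => exact Reachable.refl _
  | succ b hab ih =>
    refine (ih (by omega) fun k h1 h2 => hc k h1 (by omega)).trans (Adj.reachable ?_)
    exact ⟨hq.adj (by omega), hw, by rw [hc b hab (by omega), hc (b + 1) (by omega) le_rfl]⟩

namespace IsLayering

variable {r : V → V} {level : V → ℕ}

theorem level_geodesic_le (h : G.IsLayering r level) {q : ℕ → V} {L : ℕ} (hq : G.IsGeodesic q L)
    {i j : ℕ} (hij : i ≤ j) (hj : j ≤ L) :
    level (q i) ≤ level (q j) + (j - i) ∧ level (q j) ≤ level (q i) + (j - i) := by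
  have h1 := h.level_le (hq.reachable hij hj)
  have h2 := h.level_le (hq.reachable hij hj).symm
  rw [dist_comm] at h2
  rw [hq.dist_eq hij hj] at h1 h2
  exact ⟨h2, h1⟩

/-- The quotient `level / w` is constant along a walk of the band graph, so the walk never goes
above the first layer of its band and `dist_le_of_band` applies. -/
theorem dist_le_of_reachable_bandGraph (h : G.IsLayering r level) (hG : G.IsChordal) {w : ℕ}
    {u v : V} (huv : (G.bandGraph level w).Reachable u v) : G.dist u v ≤ 2 * w + 1 := by
  rcases Nat.eq_zero_or_pos w with rfl | hw
  · have : G.bandGraph level 0 = ⊥ := by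
      ext a b
      simp [bandGraph]
    rw [this, reachable_bot] at huv
    subst huv
    simp
  · obtain ⟨p⟩ := huv
    have key : level u / w = level v / w ∧
        (G.within {z | w * (level u / w) ≤ level z}).Reachable u v := by
      induction p with
      | nil => exact ⟨rfl, Reachable.refl _⟩
      | cons e p ih =>
        obtain ⟨ih1, ih2⟩ := ih
        rw [← e.2.2] at ih1 ih2
        refine ⟨ih1, Reachable.trans (Adj.reachable ⟨e.1, Nat.mul_div_le _ _, ?_⟩) ih2⟩
        rw [Set.mem_ofPred_eq, e.2.2]
        exact Nat.mul_div_le _ _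
    have h1 := Nat.div_add_mod (level u) w
    have h2 := Nat.div_add_mod (level v) w
    have h3 := Nat.mod_lt (level u) hw
    have h4 := Nat.mod_lt (level v) hw
    rw [← key.1] at h2
    exact h.dist_le_of_band hG key.2 (by omega) (by omega) (by omega) (by omega)

/-- A shortest path of length at most `w + 1` meets at most three components of the bands of
width `w`. -/
theorem exists_three_clusters (h : G.IsLayering r level) (hG : G.IsChordal) {w : ℕ} (hw : w ≠ 0)
    {q : ℕ → V} {L : ℕ} (hq : G.IsGeodesic q L) (hL : L ≤ w + 1) :
    ∃ m, ∀ k ≤ L, (G.bandGraph level w).Reachable (q k) (q 0) ∨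
      (G.bandGraph level w).Reachable (q k) (q m) ∨
      (G.bandGraph level w).Reachable (q k) (q L) := by
  have hw0 : 0 < w := Nat.pos_of_ne_zero hw
  obtain ⟨m, hm, hmin⟩ := Finset.exists_min_image (Finset.range (L + 1)) (fun k => level (q k))
    ⟨0, by simp⟩
  simp only [Finset.mem_range, Nat.lt_succ_iff] at hm hmin
  have lip := fun {i j : ℕ} (hij : i ≤ j) (hj : j ≤ L) => h.level_geodesic_le hq hij hj
  have qc := fun {a b c : ℕ} (hab : a ≤ b) (hbc : b ≤ c) (hc : c ≤ L) =>
    h.level_le_max hG hq hab hbc hc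
  have mono : ∀ {a b : ℕ}, a ≤ b → a / w ≤ b / w := fun hab => Nat.div_le_div_right hab
  -- If only the lowest band and the next one occur, the valley shape makes the vertices in the
  -- lowest band an interval around `m`; those before it are joined to `q 0`, those after it to `q
  -- L`.
  by_cases hcase : ∀ k ≤ L, level (q k) / w ≤ level (q m) / w + 1
  · refine ⟨m, fun k hk => ?_⟩
    have hkm := mono (hmin k hk)
    rcases hkm.eq_or_lt with heq | hlt
    · right; left
      rcases le_total k m with hle | hle
      · refine reachable_bandGraph hq hw (c := level (q m) / w) hle hm fun j h1 h2 => ?_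
        have e1 := mono (hmin j (h2.trans hm))
        have e2 := mono (qc h1 h2 hm)
        rw [max_eq_left (hmin k hk)] at e2
        omega
      · refine (reachable_bandGraph hq hw (c := level (q m) / w) hle hk fun j h1 h2 => ?_).symm
        have e1 := mono (hmin j (h2.trans hk))
        have e2 := mono (qc h1 h2 hk)
        rw [max_eq_right (hmin k hk)] at e2
        omega
    · have hlt' : level (q m) < level (q k) := by
        by_contra hcon
        have := mono (not_lt.1 hcon)
        omega
      rcases le_total k m with hle | hle
      · left
        refine (reachable_bandGraph hq hw (c := level (q m) / w + 1) (Nat.zero_le k) hk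
          fun j h1 h2 => ?_).symm
        have e1 := hcase j (h2.trans hk)
        have e2 : level (q k) ≤ level (q j) := by
          have := qc h2 hle hm
          rcases le_max_iff.1 this with h | h <;> omega
        have := mono e2
        omega
      · right; right
        refine reachable_bandGraph hq hw (c := level (q m) / w + 1) hk le_rfl fun j h1 h2 => ?_
        have e1 := hcase j h2
        have e2 : level (q k) ≤ level (q j) := by
          have := qc hle h1 h2
          rcases le_max_iff.1 this with h | h <;> omega
        have := mono e2
        omega
  · push Not at hcase
    obtain ⟨k, hk, hkm⟩ := hcase
    -- Two bands of difference cost at least `w + 1` levels. So the path has exactly `w + 1` edges,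
    -- changes level in the same direction at each of them, and has `m` and `k` as its ends; all
    -- interior vertices, among them `q 1`, lie in the middle band.
    have hdrop : level (q m) + w < level (q k) := by
      by_contra hcon
      have := mono (not_lt.1 hcon)
      rw [Nat.add_div_right _ hw0] at this
      omega
    refine ⟨1, fun j hj => ?_⟩
    rcases Nat.eq_zero_or_pos j with rfl | hj0
    · left; exact Reachable.refl _
    rcases hj.eq_or_lt with rfl | hjL
    · right; right; exact Reachable.refl _
    right; left
    have hadd : ∀ x, (x + w) / w = x / w + 1 := fun x => Nat.add_div_right x hw0
    rcases le_total k m with hle | hle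
    · have e := lip hle hm
      obtain rfl : k = 0 := by omega
      obtain rfl : m = L := by omega
      refine (reachable_bandGraph hq hw (c := level (q m) / w + 1) hj0 hj fun i h1 h2 => ?_).symm
      have e1 := lip (Nat.zero_le i) (h2.trans hj)
      have e2 := lip (h2.trans hj) le_rfl
      have e3 := hadd (level (q m))
      have e4 := hadd (level (q m) + 1)
      have e5 := mono (show level (q m) + 1 ≤ level (q i) by omega)
      have e6 := mono (show level (q i) ≤ level (q m) + w by omega)
      have e7 : level (q 0) = level (q m) + 1 + w := by omega
      rw [e7] at hkm
      omega
    · have e := lip hle hk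
      obtain rfl : m = 0 := by omega
      obtain rfl : k = L := by omega
      refine (reachable_bandGraph hq hw (c := level (q 0) / w + 1) hj0 hj fun i h1 h2 => ?_).symm
      have e1 := lip (Nat.zero_le i) (h2.trans hj)
      have e2 := lip (h2.trans hj) le_rfl
      have e3 := hadd (level (q 0))
      have e4 := hadd (level (q 0) + 1)
      have e5 := mono (show level (q 0) + 1 ≤ level (q i) by omega)
      have e6 := mono (show level (q i) ≤ level (q 0) + w by omega)
      have e7 : level (q k) = level (q 0) + 1 + w := by omega
      rw [e7] at hkm
      omega

/-- The width is the largest one with `2 * w + 1 ≤ ⌊Δ⌋₊`, and a path of length at most `Δ / 2` still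
has at most `w + 1` edges. If `w = 0`, the clusters are single vertices and the path has at most one
edge. -/
theorem isScatteringPartition (h : G.IsLayering r level) (hG : G.IsChordal) {Δ : ℝ} (hΔ : 0 < Δ) :
    G.IsScatteringPartition 2 3 Δ
      (Set.range fun v => {u | (G.bandGraph level ((⌊Δ⌋₊ - 1) / 2)).Reachable u v}) := by
  set w := (⌊Δ⌋₊ - 1) / 2 with hw
  have hfloor : (⌊Δ⌋₊ : ℝ) ≤ Δ := Nat.floor_le hΔ.le
  refine ⟨isPartition_range_reachable _, ?_, ?_, ?_⟩
  · rintro _ ⟨v, rfl⟩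
    exact induce_setOf_reachable_connected (bandGraph_le _ _) v
  · rintro _ ⟨v, rfl⟩ x hx y hy
    have hxy : (G.bandGraph level w).Reachable x y := Reachable.trans hx (Reachable.symm hy)
    refine ⟨hxy.mono (bandGraph_le _ _), ?_⟩
    rcases eq_or_ne x y with rfl | hne
    · simpa using hΔ.le
    · have hw0 : w ≠ 0 := by
        rintro h0
        obtain ⟨p⟩ := hxy
        cases p with
        | nil => exact hne rfl
        | cons e _ => exact e.2.1 h0
      have := h.dist_le_of_reachable_bandGraph hG hxy
      have h2 : G.dist x y ≤ ⌊Δ⌋₊ := by omega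
      exact (Nat.cast_le.2 h2).trans hfloor
  · intro u v p hp hlen
    have hL : 2 * p.length ≤ ⌊Δ⌋₊ := by
      apply Nat.le_floor
      push_cast
      linarith
    have hq := p.isGeodesic_getVert hp
    have hthree : ∃ m, ∀ k ≤ p.length,
        (G.bandGraph level w).Reachable (p.getVert k) (p.getVert 0) ∨
        (G.bandGraph level w).Reachable (p.getVert k) (p.getVert m) ∨
        (G.bandGraph level w).Reachable (p.getVert k) (p.getVert p.length) := by
      rcases Nat.eq_zero_or_pos w with h0 | h0
      · refine ⟨0, fun k hk => ?_⟩
        rcases (show k = 0 ∨ k = p.length by omega) with rfl | rfl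
        · exact Or.inl (Reachable.refl _)
        · exact Or.inr (Or.inr (Reachable.refl _))
      · exact h.exists_three_clusters hG h0.ne' hq (by omega)
    obtain ⟨m, hm⟩ := hthree
    let cl : V → Set V := fun v => {u | (G.bandGraph level w).Reachable u v}
    have hsub : {C ∈ Set.range cl | ∃ x ∈ p.support, x ∈ C} ⊆
        {cl (p.getVert 0), cl (p.getVert m), cl (p.getVert p.length)} := by
      rintro _ ⟨⟨c, rfl⟩, x, hx, hxc⟩
      obtain ⟨k, rfl, hk⟩ := Walk.mem_support_iff_exists_getVert.1 hx
      have hcl : ∀ y, (G.bandGraph level w).Reachable (p.getVert k) y → cl c = cl y := by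
        intro y hy
        have hcy : (G.bandGraph level w).Reachable c y := (Reachable.symm hxc).trans hy
        ext z
        exact ⟨fun hz => Reachable.trans hz hcy, fun hz => Reachable.trans hz hcy.symm⟩
      rcases hm k hk with h | h | h
      · exact Or.inl (hcl _ h)
      · exact Or.inr (Or.inl (hcl _ h))
      · exact Or.inr (Or.inr (hcl _ h))
    refine (Set.encard_le_encard hsub).trans ?_
    refine (Set.encard_insert_le _ _).trans ?_
    have := Set.encard_insert_le {cl (p.getVert p.length)} (cl (p.getVert m))
    rw [Set.encard_singleton] at this
    calc _ ≤ (1 + 1 + 1 : ℕ∞) := by gcongr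
      _ = _ := by norm_num

end IsLayering

end SimpleGraph

namespace SimpleGraph

variable {V : Type*} {G : SimpleGraph V}

/-! ### Weighted walks -/

/-- The total weight of the steps of a walk. -/
def Walk.weight (ω : V → V → ℕ) {u v : V} (p : G.Walk u v) : ℕ :=
  (p.darts.map fun d => ω d.fst d.snd).sum

namespace Walk

variable (ω : V → V → ℕ)

@[simp]
theorem weight_nil (u : V) : (Walk.nil : G.Walk u u).weight ω = 0 := rfl

@[simp]
theorem weight_cons {u v w : V} (e : G.Adj u v) (p : G.Walk v w) :
    (Walk.cons e p).weight ω = ω u v + p.weight ω := by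
  simp [weight]

@[simp]
theorem weight_append {u v w : V} (p : G.Walk u v) (q : G.Walk v w) :
    (p.append q).weight ω = p.weight ω + q.weight ω := by
  simp [weight]

theorem weight_reverse {ω : V → V → ℕ} (hω : ∀ u v, ω u v = ω v u) {u v : V} (p : G.Walk u v) :
    p.reverse.weight ω = p.weight ω := by
  induction p with
  | nil => rfl
  | cons e p ih => simp [ih, hω, add_comm]

theorem weight_eq_sum {u v : V} (p : G.Walk u v) :
    p.weight ω = ∑ k ∈ Finset.range p.length, ω (p.getVert k) (p.getVert (k + 1)) := by
  induction p with
  | nil => simp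
  | cons e p ih =>
    rw [Walk.length_cons, Finset.sum_range_succ', weight_cons, ih, add_comm]
    simp

/-- Removing loops only drops steps, and weights are nonnegative. This is what limits the number of
relaxation rounds to the number of vertices. -/
theorem exists_isPath_weight_le {u v : V} (p : G.Walk u v) :
    ∃ q : G.Walk u v, q.IsPath ∧ q.weight ω ≤ p.weight ω := by
  classical
  refine ⟨p.bypass, p.bypass_isPath, ?_⟩
  have hnd : p.bypass.darts.Nodup := Walk.darts_nodup_of_support_nodup p.bypass_isPath.support_nodup
  obtain ⟨l, hl, hs⟩ := hnd.subperm p.darts_bypass_subset_darts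
  unfold weight
  rw [← (hl.map _).sum_eq]
  exact (hs.map _).sum_le_sum (by simp)

end Walk

/-- `ρ u v` is `0` if there is no walk from `u` to `v`, and otherwise one more than the least weight
of such a walk. -/
structure IsDistCode (G : SimpleGraph V) (ω ρ : V → V → ℕ) : Prop where
  ne_zero : ∀ {u v : V}, G.Walk u v → ρ u v ≠ 0
  le : ∀ {u v : V} (p : G.Walk u v), ρ u v ≤ p.weight ω + 1
  exists_walk : ∀ {u v : V}, ρ u v ≠ 0 → ∃ p : G.Walk u v, p.weight ω + 1 = ρ u v

namespace IsDistCode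

variable {ω ρ : V → V → ℕ}

theorem ne_zero_iff (h : G.IsDistCode ω ρ) {u v : V} : ρ u v ≠ 0 ↔ G.Reachable u v :=
  ⟨fun hne => (h.exists_walk hne).elim fun p _ => p.reachable, fun ⟨p⟩ => h.ne_zero p⟩

theorem le_add_weight (h : G.IsDistCode ω ρ) {s u v : V} (hs : ρ s u ≠ 0) (p : G.Walk u v) :
    ρ s v ≤ ρ s u + p.weight ω := by
  obtain ⟨q, hq⟩ := h.exists_walk hs
  have := h.le (q.append p)
  rw [Walk.weight_append] at this
  omega

end IsDistCode

/-! ### Distance from the terminals -/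

/-- `D v` is `0` if no terminal is reachable from `v`, and otherwise one more than the distance
from `v` to the nearest terminal. -/
structure IsTerminalDistCode (G : SimpleGraph V) (K : Set V) (D : V → ℕ) : Prop where
  ne_zero : ∀ t ∈ K, ∀ v, G.Reachable t v → D v ≠ 0
  le : ∀ t ∈ K, ∀ v, G.Reachable t v → D v ≤ G.dist t v + 1
  exists_eq : ∀ v, D v ≠ 0 → ∃ t ∈ K, G.Reachable t v ∧ D v = G.dist t v + 1

namespace IsTerminalDistCode

variable {K : Set V} {D : V → ℕ}

/-- The code `0` does no harm here: if `D u = 0`, the component contains no terminal and `D v = 0`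
as well. -/
theorem le_add_dist (hD : G.IsTerminalDistCode K D) {u v : V} (huv : G.Reachable u v) :
    D v ≤ D u + G.dist u v := by
  rcases Nat.eq_zero_or_pos (D v) with h0 | h0
  · omega
  obtain ⟨t, ht, htv, -⟩ := hD.exists_eq v h0.ne'
  obtain ⟨s, hs, hsu, he⟩ := hD.exists_eq u (hD.ne_zero t ht u (htv.trans huv.symm))
  have h1 := hD.le s hs v (hsu.trans huv)
  have h2 := hsu.dist_triangle_left v
  omega

theorem le_of_adj (hD : G.IsTerminalDistCode K D) {u v : V} (huv : G.Adj u v) :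
    D v ≤ D u + 1 := by
  have := hD.le_add_dist huv.reachable
  rwa [dist_eq_one_iff_adj.2 huv] at this

theorem eq_one (hD : G.IsTerminalDistCode K D) {t : V} (ht : t ∈ K) : D t = 1 := by
  have h1 := hD.ne_zero t ht t (Reachable.refl t)
  have h2 := hD.le t ht t (Reachable.refl t)
  simp at h2
  omega

end IsTerminalDistCode

/-! ### The detour weights -/

/-- The largest power of two that divides `l` (and `1` if `l = 0`). -/
def twoPart (l : ℕ) : ℕ := 2 ^ padicValNat 2 l

theorem twoPart_dvd (l : ℕ) : twoPart l ∣ l := pow_padicValNat_dvd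

theorem two_pow_le_twoPart {i l : ℕ} (hl : l ≠ 0) (h : 2 ^ i ∣ l) : 2 ^ i ≤ twoPart l :=
  Nat.pow_le_pow_right (by norm_num) ((padicValNat_dvd_iff_le hl).1 h)

theorem twoPart_pos (l : ℕ) : 0 < twoPart l := by
  unfold twoPart; positivity

/-- The largest `D`-value up to which an edge between the layers `a` and `b` is cut. -/
def cutBound (a b : ℕ) : ℕ := if a = b then 16 else 16 * twoPart (max a b)

theorem cutBound_comm (a b : ℕ) : cutBound a b = cutBound b a := by
  simp [cutBound, eq_comm, max_comm]

theorem le_cutBound (a b : ℕ) : 16 ≤ cutBound a b := by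
  have := twoPart_pos (max a b)
  unfold cutBound
  split_ifs <;> omega

/-- The weight of an edge: zero unless the edge is cut. -/
def detour (level D : V → ℕ) (u v : V) : ℕ :=
  if D u + D v ≤ cutBound (level u) (level v) then D u + D v else 0

theorem detour_comm (level D : V → ℕ) (u v : V) : detour level D u v = detour level D v u := by
  simp [detour, cutBound_comm, add_comm]

/-- The edges of `G` that are not cut. -/
def freeGraph (G : SimpleGraph V) (level D : V → ℕ) : SimpleGraph V where
  Adj u v := G.Adj u v ∧ cutBound (level u) (level v) < D u + D v
  symm := ⟨fun u v h => ⟨h.1.symm, by rw [cutBound_comm, add_comm]; exact h.2⟩⟩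
  loopless := ⟨fun _ h => G.loopless.1 _ h.1⟩

theorem freeGraph_le (level D : V → ℕ) : G.freeGraph level D ≤ G := fun _ _ h => h.1

/-! ### Uncut components, and the weight of cuts along shortest paths -/

section detour

variable {r : V → V} {level : V → ℕ} {K : Set V} {D : V → ℕ}

/-- The components of the uncut edges have diameter bounded by the distance to the terminals. -/
theorem IsLayering.dist_le_of_reachable_freeGraph (h : G.IsLayering r level) (hG : G.IsChordal)
    (hD : G.IsTerminalDistCode K D) {v z : V} (hvz : (G.freeGraph level D).Reachable v z) :
    G.dist v z ≤ D v := by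
  rcases eq_or_ne v z with rfl | hne
  · simp
  -- The `D`-values at the ends of an uncut edge sum to more than `16` and differ by at most one.
  have h8 : 8 ≤ D v := by
    obtain ⟨p⟩ := hvz
    cases p with
    | nil => exact (hne rfl).elim
    | cons e _ =>
      have h1 := hD.le_of_adj e.1
      have h2 := e.2
      have h3 := le_cutBound (level v) (level ‹V›)
      omega
  -- The scale `P = 2 ^ i` fits `v`: a band of width `P` has components of diameter at most `2 * P +
  -- 1 ≤ D v`, and `D v ≤ 4 * P` ensures that all edges leaving the band of `v` from this component
  -- are cut.
  obtain ⟨i, hi1, hi2⟩ : ∃ i, D v ≤ 4 * 2 ^ i ∧ 2 * 2 ^ i < D v := by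
    have hex : ∃ i, D v ≤ 4 * 2 ^ i := ⟨D v, by have := (D v).lt_two_pow_self; omega⟩
    classical
    refine ⟨Nat.find hex, Nat.find_spec hex, ?_⟩
    have hmin := fun m => Nat.find_min hex (m := m)
    rcases hf : Nat.find hex with _ | j
    · have := Nat.find_spec hex
      rw [hf] at this
      omega
    · have := hmin j (by omega)
      rw [pow_succ]
      omega
  set P := 2 ^ i with hP
  have hP0 : 0 < P := by positivity
  set b := P * (level v / P) with hb
  have hdv := Nat.div_add_mod (level v) P
  have hmod := Nat.mod_lt (level v) hP0
  have key : (G.within {w | b ≤ level w}).Reachable v z ∧ b ≤ level z ∧ level z < b + P := by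
    clear hne
    rw [reachable_iff_reflTransGen] at hvz
    induction hvz with
    | refl => exact ⟨Reachable.refl _, by omega, by omega⟩
    | @tail y z _ e ih =>
      obtain ⟨ih1, ih2, ih3⟩ := ih
      have hd := h.dist_le_of_band hG ih1 (by omega) ih2 (by omega) ih3
      have hDy := hD.le_add_dist (ih1.mono (within_le _ _))
      have hDz := hD.le_of_adj e.1
      have l1 := h.level_le_of_adj e.1
      have l2 := h.level_le_of_adj e.1.symm
      have hbP : P ∣ b := ⟨_, rfl⟩
      -- Here `D y ≤ D v + 2 * P + 1 ≤ 6 * P + 1` and `D z ≤ 6 * P + 2`, with sum at most `12 * P +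
      -- 3 ≤ 16 * P`. An edge into a layer divisible by `P` from the layer before it is therefore
      -- cut.
      have hcut : ∀ m, max (level y) (level z) = m → level y ≠ level z → m ≠ 0 → P ∣ m → False := by
        intro m hm hyz hm0 hPm
        have h1 := two_pow_le_twoPart hm0 hPm
        have h2 := e.2
        rw [cutBound, if_neg hyz, hm] at h2
        omega
      have hz1 : b ≤ level z := by
        by_contra hcon
        exact hcut b (by omega) (by omega) (by omega) hbP
      have hz2 : level z < b + P := by
        by_contra hcon
        exact hcut (b + P) (by omega) (by omega) (by omega) (by simpa using hbP)
      exact ⟨ih1.trans (Adj.reachable ⟨e.1, ih2, hz1⟩), hz1, hz2⟩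
  have := h.dist_le_of_band hG key.1 (by omega) key.2.1 (by omega) key.2.2
  omega

/-- The smaller of the two powers of two divides both layers, hence also their difference, which is
less than `l`. So layers that cut at height `c` cannot be this close. -/
theorem twoPart_gap {a b c l : ℕ} (hab : a < b) (hb : b < a + l) (h1 : c ≤ 16 * twoPart a)
    (h2 : c ≤ 16 * twoPart b) (hc : 16 * (l - 1) < c) : False := by
  obtain ⟨g, hg1, hg2, hgc⟩ : ∃ g, g ∣ a ∧ g ∣ b ∧ c ≤ 16 * g := by
    rcases le_total (padicValNat 2 a) (padicValNat 2 b) with h | h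
    · exact ⟨twoPart a, twoPart_dvd a, (pow_dvd_pow 2 h).trans (twoPart_dvd b), h1⟩
    · exact ⟨twoPart b, (pow_dvd_pow 2 h).trans (twoPart_dvd a), twoPart_dvd b, h2⟩
  have := Nat.le_of_dvd (by omega) (Nat.dvd_sub hg2 hg1)
  omega

/-- The first `D / 16 + 1` edges of a shortest path have small detour weight. -/
theorem IsLayering.sum_detour_le_of_piece (h : G.IsLayering r level) (hG : G.IsChordal)
    (hD : G.IsTerminalDistCode K D) {q : ℕ → V} {l : ℕ} (hq : G.IsGeodesic q l)
    (hl : l = D (q 0) / 16 + 1) :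
    ∑ k ∈ Finset.range l, detour level D (q k) (q (k + 1)) ≤ 68 * l := by
  classical
  have hup : ∀ k ≤ l, D (q k) ≤ D (q 0) + k ∧ D (q 0) ≤ D (q k) + k := by
    intro k hk
    have hr := hq.reachable (Nat.zero_le k) hk
    have h1 := hD.le_add_dist hr
    have h2 := hD.le_add_dist hr.symm
    rw [dist_comm] at h2
    rw [hq.dist_eq (Nat.zero_le k) hk] at h1 h2
    exact ⟨h1, h2⟩
  have lip := fun {i j : ℕ} (hij : i ≤ j) (hj : j ≤ l) => h.level_geodesic_le hq hij hj
  have qc := fun {a b c : ℕ} (hab : a ≤ b) (hbc : b ≤ c) (hc : c ≤ l) =>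
    h.level_le_max hG hq hab hbc hc
  set S := (Finset.range l).filter fun k => detour level D (q k) (q (k + 1)) ≠ 0 with hS
  -- At most one cut edge goes down and at most one goes up. Two in the same direction with deeper
  -- ends in the same layer contradict the valley shape; in different layers they contradict
  -- `twoPart_gap`.
  have hcard : S.card ≤ 2 := by
    rcases Nat.lt_or_ge l 2 with hl2 | hl2
    · calc S.card ≤ (Finset.range l).card := Finset.card_filter_le _ _
        _ ≤ 2 := by simp; omega
    have hcut : ∀ k ∈ S, k < l ∧ 16 * (l - 1) < D (q k) + D (q (k + 1)) ∧
        D (q 0) + D (q 0) + 1 ≤ D (q k) + D (q (k + 1)) + 2 * l ∧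
        level (q k) ≠ level (q (k + 1)) ∧
        D (q k) + D (q (k + 1)) ≤ 16 * twoPart (max (level (q k)) (level (q (k + 1)))) := by
      intro k hk
      rw [hS, Finset.mem_filter, Finset.mem_range] at hk
      obtain ⟨hkl, hk⟩ := hk
      have h1 := hup k hkl.le
      have h2 := hup (k + 1) hkl
      have hle : D (q k) + D (q (k + 1)) ≤ cutBound (level (q k)) (level (q (k + 1))) := by
        by_contra hcon
        exact hk (if_neg hcon)
      -- For `l ≥ 2` the `D`-values on the piece are too large for an edge inside a layer to be cut.
      have hne : level (q k) ≠ level (q (k + 1)) := by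
        intro heq
        rw [cutBound, if_pos heq] at hle
        omega
      rw [cutBound, if_neg hne] at hle
      exact ⟨hkl, by omega, by omega, hne, hle⟩
    have hdown : (S.filter fun k => level (q (k + 1)) < level (q k)).card ≤ 1 := by
      have : ∀ a b, a < b → a ∈ S.filter (fun k => level (q (k + 1)) < level (q k)) →
          b ∈ S.filter (fun k => level (q (k + 1)) < level (q k)) → False := by
        intro a b hab ha hb
        rw [Finset.mem_filter] at ha hb
        obtain ⟨a1, a2, a3, -, a4⟩ := hcut a ha.1
        obtain ⟨b1, b2, b3, -, b4⟩ := hcut b hb.1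
        rw [max_eq_left ha.2.le] at a4
        rw [max_eq_left hb.2.le] at b4
        have e := lip hab.le b1.le
        rcases lt_trichotomy (level (q a)) (level (q b)) with hlt | heq | hlt
        · exact twoPart_gap (c := D (q 0) + D (q 0) + 1 - 2 * l) (l := l) hlt (by omega)
            (by omega) (by omega) (by omega)
        · have := qc (a := a + 1) (b := b) (c := b + 1) hab (by omega) b1
          rcases le_max_iff.1 this with h | h <;> omega
        · exact twoPart_gap (c := D (q 0) + D (q 0) + 1 - 2 * l) (l := l) hlt (by omega)
            (by omega) (by omega) (by omega)
      rw [Finset.card_le_one]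
      intro a ha b hb
      rcases lt_trichotomy a b with hlt | heq | hlt
      · exact (this a b hlt ha hb).elim
      · exact heq
      · exact (this b a hlt hb ha).elim
    have hupw : (S.filter fun k => ¬ level (q (k + 1)) < level (q k)).card ≤ 1 := by
      have : ∀ a b, a < b → a ∈ S.filter (fun k => ¬ level (q (k + 1)) < level (q k)) →
          b ∈ S.filter (fun k => ¬ level (q (k + 1)) < level (q k)) → False := by
        intro a b hab ha hb
        rw [Finset.mem_filter, not_lt] at ha hb
        obtain ⟨a1, a2, a3, a5, a4⟩ := hcut a ha.1
        obtain ⟨b1, b2, b3, b5, b4⟩ := hcut b hb.1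
        rw [max_eq_right ha.2] at a4
        rw [max_eq_right hb.2] at b4
        have e := lip (Nat.succ_le_succ hab.le) b1
        have e1 := lip (Nat.le_succ a) a1
        have e2 := lip (Nat.le_succ b) b1
        simp only [Nat.succ_eq_add_one] at e e1 e2
        rcases lt_trichotomy (level (q (a + 1))) (level (q (b + 1))) with hlt | heq | hlt
        · exact twoPart_gap (c := D (q 0) + D (q 0) + 1 - 2 * l) (l := l) hlt (by omega)
            (by omega) (by omega) (by omega)
        · have := qc (a := a) (b := a + 1) (c := b) (by omega) hab b1.le
          rcases le_max_iff.1 this with h | h <;> omega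
        · exact twoPart_gap (c := D (q 0) + D (q 0) + 1 - 2 * l) (l := l) hlt (by omega)
            (by omega) (by omega) (by omega)
      rw [Finset.card_le_one]
      intro a ha b hb
      rcases lt_trichotomy a b with hlt | heq | hlt
      · exact (this a b hlt ha hb).elim
      · exact heq
      · exact (this b a hlt hb ha).elim
    rw [← Finset.card_filter_add_card_filter_not (s := S)
      (fun k => level (q (k + 1)) < level (q k))]
    omega
  calc ∑ k ∈ Finset.range l, detour level D (q k) (q (k + 1))
      = ∑ k ∈ S, detour level D (q k) (q (k + 1)) := (Finset.sum_filter_ne_zero _).symm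
    _ ≤ S.card • (2 * D (q 0) + 2 * l) := by
      refine Finset.sum_le_card_nsmul _ _ _ fun k hk => ?_
      have hkl : k < l := by simpa using (Finset.mem_filter.1 hk).1
      have h1 := hup k hkl.le
      have h2 := hup (k + 1) hkl
      unfold detour
      split_ifs <;> omega
    _ ≤ 2 * (2 * D (q 0) + 2 * l) := Nat.mul_le_mul_right _ hcard
    -- Since `D (q 0) < 16 * l`, the bound `4 * D (q 0) + 4 * l` is at most `(64 + 4) * l`.
    _ ≤ 68 * l := by omega

/-- Pieces are split off from the start. The terminal at the far end gives `D (q 0) ≤ L + 1`, so a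
piece is never longer than what is left of the path. -/
theorem IsLayering.sum_detour_le (h : G.IsLayering r level) (hG : G.IsChordal)
    (hD : G.IsTerminalDistCode K D) {q : ℕ → V} {L : ℕ} (hq : G.IsGeodesic q L) (hL : q L ∈ K) :
    ∑ k ∈ Finset.range L, detour level D (q k) (q (k + 1)) ≤ 68 * L := by
  induction L using Nat.strong_induction_on generalizing q with
  | _ L ih =>
    rcases Nat.eq_zero_or_pos L with rfl | hL0
    · simp
    have hr := hq.reachable (Nat.zero_le L) le_rfl
    have h1 := hD.le _ hL _ hr.symm
    rw [dist_comm, hq.dist_eq (Nat.zero_le L) le_rfl] at h1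
    obtain ⟨l, hl⟩ : ∃ l, l = D (q 0) / 16 + 1 := ⟨_, rfl⟩
    have hlL : l ≤ L := by omega
    have hpiece := h.sum_detour_le_of_piece hG hD (hq.mono hlL) hl
    have hrest := ih (L - l) (by omega) (hq.shift hlL) (by
      simp only [Nat.add_sub_cancel' hlL]; exact hL)
    have := Finset.sum_range_add (fun k => detour level D (q k) (q (k + 1))) l (L - l)
    rw [Nat.add_sub_cancel' hlL] at this
    rw [this]
    simp only [add_assoc] at hrest hpiece ⊢
    omega

theorem IsLayering.weight_detour_le (h : G.IsLayering r level) (hG : G.IsChordal)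
    (hD : G.IsTerminalDistCode K D) {v t : V} (ht : t ∈ K) (p : G.Walk v t)
    (hp : p.length = G.dist v t) : p.weight (detour level D) ≤ 68 * p.length := by
  rw [Walk.weight_eq_sum]
  exact h.sum_detour_le hG hD (p.isGeodesic_getVert hp) (by rwa [p.getVert_length])

/-- A cut edge from `a` to `b` pays for leaving the uncut component of `a`: at most `D a` from any
of its points `y` to `a`, and `1 ≤ D b` for the edge itself. Keeping `y` where the component was
entered lets uncut edges be free. -/
theorem IsLayering.exists_dist_le_weight (h : G.IsLayering r level) (hG : G.IsChordal)
    (hD : G.IsTerminalDistCode K D) {u v : V} (p : G.Walk u v) (hu : D u ≠ 0) {y : V}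
    (hy : (G.freeGraph level D).Reachable y u) :
    ∃ z, (G.freeGraph level D).Reachable z v ∧ G.dist y z ≤ p.weight (detour level D) := by
  induction p generalizing y with
  | nil => exact ⟨y, hy, by simp⟩
  | @cons a b c e p ih =>
    have hb : D b ≠ 0 := by
      obtain ⟨t, ht, hta, -⟩ := hD.exists_eq a hu
      exact hD.ne_zero t ht b (hta.trans e.reachable)
    by_cases hcut : D a + D b ≤ cutBound (level a) (level b)
    · obtain ⟨z, hz, hdz⟩ := ih hb (Reachable.refl b)
      refine ⟨z, hz, ?_⟩
      have hya := h.dist_le_of_reachable_freeGraph hG hD hy.symm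
      have t1 := (hy.mono (freeGraph_le _ _)).dist_triangle_left z
      have t2 := e.reachable.dist_triangle_left z
      rw [dist_comm] at hya
      rw [dist_eq_one_iff_adj.2 e] at t2
      rw [Walk.weight_cons, detour, if_pos hcut]
      omega
    · obtain ⟨z, hz, hdz⟩ := ih hb (hy.trans (Adj.reachable ⟨e, not_le.1 hcut⟩))
      refine ⟨z, hz, ?_⟩
      rw [Walk.weight_cons]
      omega

theorem IsLayering.dist_le_weight_add (h : G.IsLayering r level) (hG : G.IsChordal)
    (hD : G.IsTerminalDistCode K D) {t v : V} (ht : t ∈ K) (p : G.Walk t v) :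
    G.dist t v ≤ p.weight (detour level D) + D v := by
  obtain ⟨z, hz, hd⟩ := h.exists_dist_le_weight hG hD p
    (hD.ne_zero t ht t (Reachable.refl t)) (Reachable.refl t)
  have h1 := h.dist_le_of_reachable_freeGraph hG hD hz.symm
  rw [dist_comm] at h1
  have := (hz.mono (freeGraph_le _ _)).dist_triangle_right t
  omega

end detour

/-! ### Voronoi cells and Steiner point removal -/

/-- The terminal `t` is nearest to `v` with respect to `ρ`, ties being broken by `num`. -/
structure IsNearest (K : Set V) (ρ : V → V → ℕ) (num : V → ℕ) (t v : V) : Prop where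
  mem : t ∈ K
  ne_zero : ρ t v ≠ 0
  le : ∀ s ∈ K, ρ s v ≠ 0 → ρ t v < ρ s v ∨ (ρ t v = ρ s v ∧ num t ≤ num s)

namespace IsNearest

variable {K : Set V} {ω ρ : V → V → ℕ} {num : V → ℕ}

theorem unique (hnum : Function.Injective num) {s t v : V} (hs : IsNearest K ρ num s v)
    (ht : IsNearest K ρ num t v) : s = t := by
  have h1 := hs.le t ht.mem ht.ne_zero
  have h2 := ht.le s hs.mem hs.ne_zero
  exact hnum (by omega)

theorem exists_of_ne_zero (K : Set V) (ρ : V → V → ℕ) (num : V → ℕ) {s v : V} (hs : s ∈ K)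
    (hsv : ρ s v ≠ 0) : ∃ t, IsNearest K ρ num t v := by
  obtain ⟨t, ⟨ht, htv⟩, hmin⟩ := (InvImage.wf (fun t => toLex (ρ t v, num t))
    (wellFounded_lt (α := ℕ ×ₗ ℕ))).has_min {t | t ∈ K ∧ ρ t v ≠ 0} ⟨s, hs, hsv⟩
  refine ⟨t, ht, htv, fun u hu huv => ?_⟩
  have := hmin u ⟨hu, huv⟩
  simp only [InvImage, Prod.Lex.toLex_lt_toLex] at this
  omega

/-- On a lightest walk from `t` to `v`, a terminal preferred to `t` at some vertex would also be
preferred at `v`. This makes Voronoi cells connected, even with zero weights, because ties are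
broken by a fixed numbering. -/
theorem exists_walk (hρ : G.IsDistCode ω ρ) {t v : V} (h : IsNearest K ρ num t v) :
    ∃ p : G.Walk t v, ∀ y ∈ p.support, IsNearest K ρ num t y := by
  classical
  obtain ⟨p, hp⟩ := hρ.exists_walk h.ne_zero
  refine ⟨p, fun y hy => ?_⟩
  have hsplit := congrArg (Walk.weight ω) (p.take_spec hy)
  rw [Walk.weight_append] at hsplit
  have h1 := hρ.le (p.takeUntil y hy)
  refine ⟨h.mem, hρ.ne_zero (p.takeUntil y hy), fun s hs hsy => ?_⟩
  have h2 := hρ.le_add_weight hsy (p.dropUntil y hy)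
  have h3 := h.le s hs
    (hρ.ne_zero_iff.2 ((hρ.ne_zero_iff.1 hsy).trans (p.dropUntil y hy).reachable))
  omega

/-- The ends of an edge of weight zero have the same distance from every vertex. Hence cells change
only at cut edges. -/
theorem of_weight_zero (hρ : G.IsDistCode ω ρ) (hω : ∀ u v, ω u v = ω v u) {t u v : V}
    (huv : G.Adj u v) (h0 : ω u v = 0) (h : IsNearest K ρ num t u) : IsNearest K ρ num t v := by
  have h1 : ∀ s, ρ s v = ρ s u := by
    intro s
    by_cases hs : G.Reachable s u
    · have hs' := hs.trans huv.reachable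
      have e1 := hρ.le_add_weight (hρ.ne_zero_iff.2 hs) huv.toWalk
      have e2 := hρ.le_add_weight (hρ.ne_zero_iff.2 hs') huv.symm.toWalk
      simp [Adj.toWalk, h0, hω v u] at e1 e2
      omega
    · have hs' : ¬ G.Reachable s v := fun hc => hs (hc.trans huv.symm.reachable)
      rw [← hρ.ne_zero_iff, not_not] at hs hs'
      omega
  refine ⟨h.mem, ?_, fun s hs hsv => ?_⟩
  · rw [h1]; exact h.ne_zero
  · rw [h1] at hsv
    rw [h1, h1]
    exact h.le s hs hsv

end IsNearest

/-- The minor obtained by contracting the Voronoi cells. -/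
def voronoiMinor (G : SimpleGraph V) (K : Set V) (ρ : V → V → ℕ) (num : V → ℕ) :
    SimpleGraph K where
  Adj s t := s ≠ t ∧ ∃ x y, G.Adj x y ∧ IsNearest K ρ num s x ∧ IsNearest K ρ num t y
  symm := ⟨fun _ _ ⟨hne, x, y, h, hx, hy⟩ => ⟨hne.symm, y, x, h.symm, hy, hx⟩⟩
  loopless := ⟨fun _ h => h.1 rfl⟩

/-- Edges between terminals weighted by the distance in `G`. -/
noncomputable def distWeight (G : SimpleGraph V) (K : Set V) : Sym2 K → ℕ :=
  Sym2.lift ⟨fun s t => G.dist s t, fun _ _ => dist_comm⟩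

theorem sum_map_natCast {α : Type*} (l : List α) (f : α → ℕ) :
    (l.map fun x => (f x : ℝ≥0)).sum = ((l.map f).sum : ℕ) := by
  induction l with
  | nil => simp
  | cons a l ih => simp only [List.map_cons, List.sum_cons, Nat.cast_add, ih]

/-- The lower bound is the triangle inequality, as minor edges carry distances of `G`. For the upper
bound, the minor is traversed along the cells met by a shortest path between the terminals. -/
theorem IsLayering.isSPRSolution {r : V → V} {level : V → ℕ} {K : Set V} {D : V → ℕ}
    {ρ : V → V → ℕ} {num : V → ℕ} (h : G.IsLayering r level) (hG : G.IsChordal)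
    (hD : G.IsTerminalDistCode K D) (hρ : G.IsDistCode (detour level D) ρ)
    (hnum : Function.Injective num) :
    G.IsSPRSolution K 4760 (G.voronoiMinor K ρ num) (fun x => (G.distWeight K x : ℝ≥0)) := by
  -- Every edge at a terminal is cut, its `D`-values being `1` and at most `2`, so walks from other
  -- terminals have positive weight.
  have hself : ∀ t ∈ K, IsNearest K ρ num t t := by
    intro t ht
    refine ⟨ht, hρ.ne_zero Walk.nil, fun s hs hst => ?_⟩
    have h1 := hρ.le (Walk.nil : G.Walk t t)
    obtain ⟨p, hp⟩ := hρ.exists_walk hst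
    cases p with
    | nil => exact Or.inr ⟨rfl, le_rfl⟩
    | @cons _ b _ e p =>
      left
      have e1 := hD.eq_one hs
      have e2 := hD.le_of_adj e
      have e3 := le_cutBound (level s) (level b)
      rw [Walk.weight_cons, detour, if_pos (by omega)] at hp
      simp at h1
      omega
  have hreach : ∀ {t v}, IsNearest K ρ num t v → G.Reachable t v :=
    fun hn => hρ.ne_zero_iff.1 hn.ne_zero
  -- The weight from `t` to `v` is at most that from the terminal nearest in `G`, thus at most `68 *
  -- (D v - 1)`; another `D v` covers the uncut component of `v`.
  have hdist : ∀ {t v}, IsNearest K ρ num t v → G.dist t v ≤ 69 * D v := by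
    intro t v hn
    obtain ⟨p, hp⟩ := hρ.exists_walk hn.ne_zero
    have h1 := h.dist_le_weight_add hG hD hn.mem p
    obtain ⟨s, hs, hsv, hDv⟩ := hD.exists_eq v (hD.ne_zero t hn.mem v (hreach hn))
    obtain ⟨q, hq⟩ := hsv.symm.exists_walk_length_eq_dist
    have h2 := h.weight_detour_le hG hD hs q hq
    have h3 := hρ.le q.reverse
    rw [Walk.weight_reverse (detour_comm level D)] at h3
    rw [dist_comm] at hq
    have h4 := hn.le s hs (hρ.ne_zero_iff.2 hsv)
    omega
  have hreachM : ∀ {s t : K}, (G.voronoiMinor K ρ num).Adj s t → G.Reachable (s : V) t := by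
    rintro s t ⟨-, x, y, hxy, hx, hy⟩
    exact (hreach hx).trans (hxy.reachable.trans (hreach hy).symm)
  refine ⟨⟨fun t => {v | IsNearest K ρ num t v}, ?_, ?_, ?_, ?_⟩, ?_, ?_⟩
  · exact fun t => hself t t.2
  · refine fun t => induce_connected_of_walks (x := (t : V)) (hself t t.2) fun v hv => ?_
    exact IsNearest.exists_walk hρ hv
  · intro s t hst
    rw [Set.disjoint_left]
    intro v hs ht
    exact hst (Subtype.ext (IsNearest.unique hnum hs ht))
  · rintro s t ⟨-, x, y, hxy, hx, hy⟩
    exact ⟨x, hx, y, hy, hxy⟩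
  · intro s t
    refine le_iInf fun p => ?_
    have : G.edist (s : V) t ≤ ((p.edges.map (G.distWeight K)).sum : ℕ∞) := by
      induction p with
      | nil => simp
      | @cons a b c e p ih =>
        refine SimpleGraph.edist_triangle (v := (b : V)) |>.trans ?_
        simp only [Walk.edges_cons, List.map_cons, List.sum_cons, Nat.cast_add]
        refine add_le_add ?_ ih
        rw [← (hreachM e).coe_dist_eq_edist]
        exact le_rfl
    rw [sum_map_natCast]
    generalize (p.edges.map (G.distWeight K)).sum = N at this ⊢
    simpa using ENat.toENNReal_le.2 this
  · intro s t
    by_cases hst : G.Reachable (s : V) t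
    swap
    · rw [edist_eq_top_of_not_reachable hst]
      simp
    obtain ⟨q, hq0, hq1, hq⟩ := hst.exists_isGeodesic
    set L := G.dist (s : V) t with hL
    -- A change of cells across an edge of weight `D (q k) + D (q (k + 1))` costs at most `69` times
    -- this weight plus one for the edge, hence the factor `70`.
    have key : ∀ k ≤ L, ∀ u : K, IsNearest K ρ num u (q k) →
        ∃ p : (G.voronoiMinor K ρ num).Walk s u, (p.edges.map (G.distWeight K)).sum ≤
          70 * ∑ j ∈ Finset.range k, detour level D (q j) (q (j + 1)) := by
      intro k
      induction k with
      | zero =>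
        intro _ u hu
        rw [hq0] at hu
        obtain rfl : s = u := Subtype.ext (IsNearest.unique hnum (hself s s.2) hu)
        exact ⟨Walk.nil, by simp⟩
      | succ k ih =>
        intro hk u hu
        have hadj := hq.adj (k := k) (by omega)
        obtain ⟨y', hy⟩ := IsNearest.exists_of_ne_zero K ρ num u.2
          (hρ.ne_zero_iff.2 ((hreach hu).trans hadj.symm.reachable))
        obtain ⟨y, rfl⟩ : ∃ y : K, (y : V) = y' := ⟨⟨y', hy.mem⟩, rfl⟩
        obtain ⟨p, hp⟩ := ih (by omega) y hy
        rw [Finset.sum_range_succ]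
        by_cases hyu : y = u
        · subst hyu
          exact ⟨p, by omega⟩
        have hw : detour level D (q k) (q (k + 1)) ≠ 0 := fun h0 =>
          hyu (Subtype.ext (IsNearest.unique hnum
            (hy.of_weight_zero hρ (detour_comm level D) hadj h0) hu))
        have hcut : D (q k) + D (q (k + 1)) ≤ cutBound (level (q k)) (level (q (k + 1))) := by
          by_contra hcon
          exact hw (if_neg hcon)
        have hM : (G.voronoiMinor K ρ num).Adj y u := ⟨hyu, q k, q (k + 1), hadj, hy, hu⟩
        refine ⟨p.concat hM, ?_⟩
        have hval : G.distWeight K s(y, u) = G.dist (y : V) u := rfl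
        rw [Walk.edges_concat, List.concat_eq_append, List.map_append, List.sum_append]
        simp only [List.map_cons, List.map_nil, List.sum_cons, List.sum_nil, add_zero, hval]
        have t1 := (hreach hy).dist_triangle_left u
        have t2 := hadj.reachable.dist_triangle_left (u : V)
        rw [dist_eq_one_iff_adj.2 hadj, dist_comm (u := q (k + 1))] at t2
        have d1 := hdist hy
        have d2 := hdist hu
        have hdet : detour level D (q k) (q (k + 1)) = D (q k) + D (q (k + 1)) := if_pos hcut
        omega
    obtain ⟨p, hp⟩ := key L le_rfl t (by rw [hq1]; exact hself t t.2)
    have hsum := h.sum_detour_le hG hD hq (by rw [hq1]; exact t.2)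
    have hfin : (p.edges.map (G.distWeight K)).sum ≤ 4760 * L := by omega
    refine (iInf_le _ p).trans ?_
    rw [← hst.coe_dist_eq_edist, ← hL]
    rw [sum_map_natCast]
    generalize (p.edges.map (G.distWeight K)).sum = N at hfin ⊢
    have := (Nat.cast_le (α := ℝ≥0∞)).2 hfin
    simpa using this

end SimpleGraph

namespace RAM

/-! ### Rules for halting programs -/

theorem HaltsWithin.mono {c : Prog} {s : Store} {T T' : ℕ} {Q Q' : Store → Prop}
    (h : HaltsWithin c s T Q) (hT : T ≤ T') (hQ : ∀ s', Q s' → Q' s') : HaltsWithin c s T' Q' := by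
  obtain ⟨t, s', ht, he, hq⟩ := h
  exact ⟨t, s', ht.trans hT, he, hQ _ hq⟩

theorem haltsWithin_skip {s : Store} {Q : Store → Prop} (h : Q s) : HaltsWithin .skip s 1 Q :=
  ⟨1, s, le_rfl, .skip s, h⟩

theorem haltsWithin_write {s : Store} {a : ℕ} {i j x : Expr} {Q : Store → Prop}
    (h : Q (s.set a (i.eval s) (j.eval s) (x.eval s))) :
    HaltsWithin (.write a i j x) s (i.cost + j.cost + x.cost + 1) Q :=
  ⟨_, _, le_rfl, .write s a i j x, h⟩

theorem HaltsWithin.seq {c d : Prog} {s : Store} {T₁ T₂ : ℕ} {R Q : Store → Prop}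
    (hc : HaltsWithin c s T₁ R) (hd : ∀ s', R s' → HaltsWithin d s' T₂ Q) :
    HaltsWithin (.seq c d) s (T₁ + T₂) Q := by
  obtain ⟨t₁, s₁, ht₁, he₁, hr⟩ := hc
  obtain ⟨t₂, s₂, ht₂, he₂, hq⟩ := hd s₁ hr
  exact ⟨t₁ + t₂, s₂, by omega, .seq he₁ he₂, hq⟩

theorem haltsWithin_branch {x : Expr} {c d : Prog} {s : Store} {T : ℕ} {Q : Store → Prop}
    (hc : x.eval s ≠ 0 → HaltsWithin c s T Q) (hd : x.eval s = 0 → HaltsWithin d s T Q) :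
    HaltsWithin (.branch x c d) s (x.cost + T + 1) Q := by
  by_cases hx : x.eval s = 0
  · obtain ⟨t, s', ht, he, hq⟩ := hd hx
    exact ⟨_, s', by omega, .branchElse hx he, hq⟩
  · obtain ⟨t, s', ht, he, hq⟩ := hc hx
    exact ⟨_, s', by omega, .branchThen hx he, hq⟩

theorem Store.set_apply (s : Store) (a i j x a' i' j' : ℕ) :
    s.set a i j x a' i' j' = if a' = a ∧ i' = i ∧ j' = j then x else s a' i' j' := rfl

/-- The cell `(r, c)` of array `1` as an expression. -/
def cell (r c : ℕ) : Expr := .read 1 (.lit r) (.lit c)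

@[simp] theorem cell_eval (r c : ℕ) (s : Store) : (cell r c).eval s = s 1 r c := rfl

@[simp] theorem cell_cost (r c : ℕ) : (cell r c).cost = 3 := rfl

/-- The assignment of `x` to the cell `(r, c)` of array `1`. -/
def assign (r c : ℕ) (x : Expr) : Prog := .write 1 (.lit r) (.lit c) x

theorem haltsWithin_assign {s : Store} {r c : ℕ} {x : Expr} {Q : Store → Prop}
    (h : Q (s.set 1 r c (x.eval s))) : HaltsWithin (assign r c x) s (x.cost + 3) Q :=
  (haltsWithin_write (i := .lit r) (j := .lit c) h).mono (by simp [Expr.cost]; omega) fun _ => id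

/-- The loop that runs `body` with the counter in cell `(r, c)` of array `1` going through the
numbers less than the content of cell `(0, 0)`. -/
def forLoop (r c : ℕ) (body : Prog) : Prog :=
  .seq (assign r c (.lit 0)) (.loop (.sub (cell 0 0) (cell r c))
    (.seq body (assign r c (.add (cell r c) (.lit 1)))))

/-- The condition `c ≠ 0` keeps the counter away from the size in cell `(0, 0)`. The invariant
refers to the store after the counter has been incremented. -/
theorem haltsWithin_forLoop {r c N T : ℕ} {body : Prog} {Inv : ℕ → Store → Prop} (hc : c ≠ 0)
    (hbody : ∀ i s, i < N → Inv i s → s 1 0 0 = N → s 1 r c = i →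
      HaltsWithin body s T fun s' =>
        (s' 1 0 0 = N ∧ s' 1 r c = i) ∧ Inv (i + 1) (s'.set 1 r c (i + 1)))
    {s : Store} (hN : s 1 0 0 = N) (h0 : Inv 0 (s.set 1 r c 0)) :
    HaltsWithin (forLoop r c body) s (N * (T + 16) + 12) fun s' => Inv N s' ∧ s' 1 0 0 = N := by
  have key : ∀ k i s, i + k = N → Inv i s → s 1 0 0 = N → s 1 r c = i →
      HaltsWithin (.loop (.sub (cell 0 0) (cell r c))
        (.seq body (assign r c (.add (cell r c) (.lit 1))))) s (k * (T + 16) + 8)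
        fun s' => Inv N s' ∧ s' 1 0 0 = N := by
    intro k
    induction k with
    | zero =>
      intro i s hi hinv hs hsi
      have hz : (Expr.sub (cell 0 0) (cell r c)).eval s = 0 := by
        simp [Expr.eval, hs, hsi]; omega
      obtain rfl : i = N := by omega
      exact ⟨_, s, by simp [Expr.cost], .loopStop hz, hinv, hs⟩
    | succ k ih =>
      intro i s hi hinv hs hsi
      have hz : (Expr.sub (cell 0 0) (cell r c)).eval s ≠ 0 := by
        simp [Expr.eval, hs, hsi]; omega
      obtain ⟨t₁, s₁, ht₁, he₁, ⟨hs₁, hr₁⟩, hi₁⟩ := hbody i s (by omega) hinv hs hsi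
      have hw : HaltsWithin (assign r c (.add (cell r c) (.lit 1))) s₁ 8
          (fun s' => s' = s₁.set 1 r c (i + 1)) :=
        (haltsWithin_assign (by simp [Expr.eval, hr₁])).mono (by simp [Expr.cost]) fun _ => id
      obtain ⟨t₂, s₂, ht₂, he₂, rfl⟩ := hw
      obtain ⟨t₃, s₃, ht₃, he₃, hq⟩ := ih (i + 1) _ (by omega) hi₁
        (by simp [Store.set_apply, hs₁, hc.symm]) (by simp [Store.set_apply])
      refine ⟨_, s₃, ?_, .loopStep hz (.seq he₁ he₂) he₃, hq⟩
      simp only [Expr.cost, cell_cost]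
      rw [Nat.add_mul]
      omega
  have h1 : HaltsWithin (assign r c (.lit 0)) s 4 (fun s' => s' = s.set 1 r c 0) :=
    (haltsWithin_assign (by simp [Expr.eval])).mono (by simp [Expr.cost]) fun _ => id
  refine (h1.seq (T₂ := N * (T + 16) + 8) ?_).mono (by omega) fun _ => id
  rintro _ rfl
  exact key N 0 _ (by omega) h0 (by simp [Store.set_apply, hN, hc.symm])
    (by simp [Store.set_apply])

/-! ### Terms with bounded minimization -/

/-- The smaller one of two numbers, where `0` counts as infinite. -/
def better (x y : ℕ) : ℕ := if y = 0 then x else if x = 0 then y else if y < x then y else x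

/-- The least nonzero value of `g` at the numbers less than `n`, and `0` if there is none. -/
def best (n : ℕ) (g : ℕ → ℕ) : ℕ :=
  match n with
  | 0 => 0
  | k + 1 => better (best k g) (g k)

theorem best_eq_zero_iff {n : ℕ} {g : ℕ → ℕ} : best n g = 0 ↔ ∀ i < n, g i = 0 := by
  induction n with
  | zero => simp [best]
  | succ k ih =>
    rw [best, better, Nat.forall_lt_succ_right, ← ih]
    split_ifs <;> omega

theorem best_le {n : ℕ} {g : ℕ → ℕ} {i : ℕ} (hi : i < n) (hg : g i ≠ 0) : best n g ≤ g i := by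
  induction n with
  | zero => omega
  | succ k ih =>
    rw [best, better]
    rcases Nat.lt_succ_iff_lt_or_eq.1 hi with h | rfl
    · have := ih h
      have : best k g ≠ 0 := fun h0 => hg (best_eq_zero_iff.1 h0 i h)
      split_ifs <;> omega
    · split_ifs <;> omega

theorem exists_best_eq {n : ℕ} {g : ℕ → ℕ} (h : best n g ≠ 0) : ∃ i < n, best n g = g i := by
  induction n with
  | zero => simp [best] at h
  | succ k ih =>
    rw [best, better] at h ⊢
    split_ifs at h ⊢ with h1 h2 h3
    · obtain ⟨i, hi, he⟩ := ih h
      exact ⟨i, by omega, he⟩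
    · exact ⟨k, by omega, rfl⟩
    · exact ⟨k, by omega, rfl⟩
    · obtain ⟨i, hi, he⟩ := ih h
      exact ⟨i, by omega, he⟩

/-- Terms over the arrays, in variables numbered from the outside to the inside. -/
inductive Term : Type
  | lit (k : ℕ) : Term
  | size : Term
  | var (i : ℕ) : Term
  | read (a : ℕ) (i j : Term) : Term
  | add (x y : Term) : Term
  | sub (x y : Term) : Term
  | ite (c x y : Term) : Term
  | best (x : Term) : Term

namespace Term

/-- The number `x` if `c ≠ 0`, and `y` if `c = 0`. -/
def pick (c x y : ℕ) : ℕ := if c ≠ 0 then x else y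

def eval (n : ℕ) (m : Store) : Term → List ℕ → ℕ
  | .lit k, _ => k
  | .size, _ => n
  | .var i, env => env.getD i 0
  | .read a i j, env => m a (i.eval n m env) (j.eval n m env)
  | .add x y, env => x.eval n m env + y.eval n m env
  | .sub x y, env => x.eval n m env - y.eval n m env
  | .ite c x y, env => pick (c.eval n m env) (x.eval n m env) (y.eval n m env)
  | .best x, env => RAM.best n fun i => x.eval n m (env ++ [i])

/-- The array of the machine that holds the array `a` of a term; array `1` is reserved for the
size of the input, variables, temporary results and counters. -/
def phys (a : ℕ) : ℕ := if a = 0 then 0 else a + 1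

theorem phys_ne_one (a : ℕ) : phys a ≠ 1 := by
  unfold phys; split_ifs <;> omega

theorem phys_injective : Function.Injective phys := by
  intro a b h
  unfold phys at h
  split_ifs at h <;> omega

/-- The program that writes the value of a term with `d` free variables to the temporary cell
`t`. -/
def compile : Term → ℕ → ℕ → Prog
  | .lit k, _, t => assign t 2 (.lit k)
  | .size, _, t => assign t 2 (cell 0 0)
  | .var i, d, t => assign t 2 (if i < d then cell i 1 else .lit 0)
  | .read a i j, d, t => .seq (i.compile d t) (.seq (j.compile d (t + 1))
      (assign t 2 (.read (phys a) (cell t 2) (cell (t + 1) 2))))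
  | .add x y, d, t => .seq (x.compile d t) (.seq (y.compile d (t + 1))
      (assign t 2 (.add (cell t 2) (cell (t + 1) 2))))
  | .sub x y, d, t => .seq (x.compile d t) (.seq (y.compile d (t + 1))
      (assign t 2 (.sub (cell t 2) (cell (t + 1) 2))))
  | .ite c x y, d, t => .seq (c.compile d t) (.branch (cell t 2) (x.compile d t) (y.compile d t))
  | .best x, d, t => .seq (assign t 2 (.lit 0)) (forLoop d 1 (.seq (x.compile (d + 1) (t + 1))
      (.branch (cell (t + 1) 2)
        (.branch (cell t 2)
          (.branch (.sub (cell t 2) (cell (t + 1) 2)) (assign t 2 (cell (t + 1) 2)) .skip)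
          (assign t 2 (cell (t + 1) 2)))
        .skip)))

open Polynomial in
/-- A bound for the running time of the compiled term. -/
noncomputable def time : Term → Polynomial ℕ
  | .lit _ => 10
  | .size => 10
  | .var _ => 10
  | .read _ i j => i.time + j.time + 20
  | .add x y => x.time + y.time + 20
  | .sub x y => x.time + y.time + 20
  | .ite c x y => c.time + (x.time + y.time) + 20
  | .best x => X * (x.time + 60) + 40

/-- The store `s` of the machine represents the arrays `m` for inputs of size `N`. -/
structure Rep (N : ℕ) (m s : Store) : Prop where
  size : s 1 0 0 = N
  arrays : ∀ a, s (phys a) = m a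

/-- Only variables from `d` on and temporary cells from `t` on differ between `s` and `s'`. -/
def Frame (d t : ℕ) (s s' : Store) : Prop :=
  ∀ a i j, ¬ (a = 1 ∧ ((j = 1 ∧ d ≤ i) ∨ (j = 2 ∧ t ≤ i))) → s' a i j = s a i j

theorem Frame.refl (d t : ℕ) (s : Store) : Frame d t s s := fun _ _ _ _ => rfl

theorem Frame.trans {d t : ℕ} {s₁ s₂ s₃ : Store} (h₁ : Frame d t s₁ s₂) (h₂ : Frame d t s₂ s₃) :
    Frame d t s₁ s₃ := fun a i j h => (h₂ a i j h).trans (h₁ a i j h)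

theorem Frame.mono {d t d' t' : ℕ} {s s' : Store} (h : Frame d' t' s s') (hd : d ≤ d')
    (ht : t ≤ t') : Frame d t s s' := fun a i j hn => h a i j (by omega)

theorem Frame.set_temp {d t : ℕ} {s s' : Store} (h : Frame d t s s') {r : ℕ} (hr : t ≤ r) (x : ℕ) :
    Frame d t s (s'.set 1 r 2 x) := by
  intro a i j hn
  rw [Store.set_apply, if_neg (by omega), h a i j hn]

theorem Frame.set_var {d t : ℕ} {s s' : Store} (h : Frame d t s s') {r : ℕ} (hr : d ≤ r) (x : ℕ) :
    Frame d t s (s'.set 1 r 1 x) := by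
  intro a i j hn
  rw [Store.set_apply, if_neg (by omega), h a i j hn]

theorem Frame.rep {d t N : ℕ} {s s' m : Store} (h : Frame d t s s') (hs : Rep N m s) :
    Rep N m s' := by
  refine ⟨?_, fun a => ?_⟩
  · rw [h 1 0 0 (by omega), hs.size]
  · funext i j
    rw [h _ i j (by have := phys_ne_one a; omega), hs.arrays]

/-- Temporary cells work as a stack: the first operand stays in cell `t` while the second one is
computed in the cells from `t + 1` on, which `Frame` records. Reads, sums and differences share the
argument `binary`. -/
theorem haltsWithin_compile {N : ℕ} {m : Store} (T : Term) :
    ∀ (env : List ℕ) (t : ℕ) (s : Store), Rep N m s →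
      (∀ k < env.length, s 1 k 1 = env.getD k 0) →
      HaltsWithin (T.compile env.length t) s (T.time.eval N)
        fun s' => Frame env.length t s s' ∧ s' 1 t 2 = T.eval N m env := by
  have binary : ∀ (x y : Term) (op : Expr → Expr → Expr) (f : ℕ → ℕ → ℕ),
      (∀ u v s, (op u v).cost = u.cost + v.cost + 1 ∧
        (Rep N m s → (op u v).eval s = f (u.eval s) (v.eval s))) →
      (∀ (env : List ℕ) (t : ℕ) (s : Store), Rep N m s →
        (∀ k < env.length, s 1 k 1 = env.getD k 0) →
        HaltsWithin (x.compile env.length t) s (x.time.eval N)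
          fun s' => Frame env.length t s s' ∧ s' 1 t 2 = x.eval N m env) →
      (∀ (env : List ℕ) (t : ℕ) (s : Store), Rep N m s →
        (∀ k < env.length, s 1 k 1 = env.getD k 0) →
        HaltsWithin (y.compile env.length t) s (y.time.eval N)
          fun s' => Frame env.length t s s' ∧ s' 1 t 2 = y.eval N m env) →
      ∀ (env : List ℕ) (t : ℕ) (s : Store), Rep N m s →
        (∀ k < env.length, s 1 k 1 = env.getD k 0) →
        HaltsWithin (.seq (x.compile env.length t) (.seq (y.compile env.length (t + 1))
          (assign t 2 (op (cell t 2) (cell (t + 1) 2))))) s ((x.time + y.time + 20).eval N)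
          fun s' => Frame env.length t s s' ∧
            s' 1 t 2 = f (x.eval N m env) (y.eval N m env) := by
    intro x y op f hop hx hy env t s hs henv
    refine ((hx env t s hs henv).seq (T₂ := y.time.eval N + 20) ?_).mono
      (by simp; omega) fun _ => id
    rintro s₁ ⟨hf₁, hv₁⟩
    refine (hy env (t + 1) s₁ (hf₁.rep hs) ?_).seq ?_
    · intro k hk
      rw [hf₁ 1 k 1 (by omega), henv k hk]
    rintro s₂ ⟨hf₂, hv₂⟩
    refine (haltsWithin_assign ?_).mono ?_ fun _ => id
    · refine ⟨(hf₁.trans (hf₂.mono le_rfl (by omega))).set_temp le_rfl _, ?_⟩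
      rw [Store.set_apply, if_pos ⟨rfl, rfl, rfl⟩,
        (hop _ _ s₂).2 (hf₂.rep (hf₁.rep hs)), cell_eval, cell_eval, hv₂,
        hf₂ 1 t 2 (by omega), hv₁]
    · have := (hop (cell t 2) (cell (t + 1) 2) s₂).1
      simp only [cell_cost] at this
      omega
  induction T with
  | lit k =>
    intro env t s hs _
    refine (haltsWithin_assign ⟨(Frame.refl _ _ s).set_temp le_rfl _, ?_⟩).mono ?_ fun _ => id
    · simp [time, Expr.cost]
    · simp [Store.set_apply, Expr.eval, eval]
  | size =>
    intro env t s hs _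
    refine (haltsWithin_assign ⟨(Frame.refl _ _ s).set_temp le_rfl _, ?_⟩).mono ?_ fun _ => id
    · simp [time]
    · simp [Store.set_apply, eval, hs.size]
  | var i =>
    intro env t s hs henv
    refine (haltsWithin_assign ⟨(Frame.refl _ _ s).set_temp le_rfl _, ?_⟩).mono ?_ fun _ => id
    · split_ifs <;> simp [time, Expr.cost]
    · by_cases hi : i < env.length
      · simp only [Store.set_apply, eval, hi, if_true, and_self, cell_eval]
        exact henv i hi
      · simp [Store.set_apply, eval, hi, Expr.eval]
  | read a i j ihi ihj =>
    exact binary i j (.read (phys a)) (fun x y => m a x y)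
      (fun u v s => ⟨rfl, fun hs => by rw [Expr.eval, hs.arrays]⟩) ihi ihj
  | add x y ihx ihy =>
    exact binary x y .add (fun x y => x + y) (fun u v s => ⟨rfl, fun _ => rfl⟩) ihx ihy
  | sub x y ihx ihy =>
    exact binary x y .sub (fun x y => x - y) (fun u v s => ⟨rfl, fun _ => rfl⟩) ihx ihy
  | ite c x y ihc ihx ihy =>
    intro env t s hs henv
    refine ((ihc env t s hs henv).seq
      (T₂ := (cell t 2).cost + (x.time.eval N + y.time.eval N) + 1) ?_).mono
      (by simp [time]; omega) fun _ => id
    rintro s₁ ⟨hf₁, hv₁⟩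
    have henv₁ : ∀ k < env.length, s₁ 1 k 1 = env.getD k 0 := fun k hk => by
      rw [hf₁ 1 k 1 (by omega), henv k hk]
    refine haltsWithin_branch (fun hc => ?_) (fun hc => ?_)
    · rw [cell_eval, hv₁] at hc
      refine (ihx env t s₁ (hf₁.rep hs) henv₁).mono (by omega) ?_
      rintro s' ⟨hf, hv⟩
      exact ⟨hf₁.trans hf, by rw [hv, eval, pick, if_pos hc]⟩
    · rw [cell_eval, hv₁] at hc
      refine (ihy env t s₁ (hf₁.rep hs) henv₁).mono (by omega) ?_
      rintro s' ⟨hf, hv⟩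
      exact ⟨hf₁.trans hf, by rw [hv, eval, pick, if_neg (not_not.2 hc)]⟩
  | best x ih =>
    intro env t s hs henv
    set g : ℕ → ℕ := fun i => x.eval N m (env ++ [i]) with hg
    have hfor := haltsWithin_forLoop (r := env.length) (c := 1) (N := N)
      (T := x.time.eval N + 30)
      (body := .seq (x.compile (env.length + 1) (t + 1))
        (.branch (cell (t + 1) 2)
          (.branch (cell t 2)
            (.branch (.sub (cell t 2) (cell (t + 1) 2)) (assign t 2 (cell (t + 1) 2)) .skip)
            (assign t 2 (cell (t + 1) 2)))
          .skip))
      (Inv := fun i s' => Frame env.length t s s' ∧ s' 1 t 2 = RAM.best i g) one_ne_zero ?_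
      (s := s.set 1 t 2 0) (by simp [Store.set_apply, hs.size])
      ⟨((Frame.refl _ _ s).set_temp le_rfl _).set_var le_rfl _, by simp [Store.set_apply, RAM.best]⟩
    · refine ((haltsWithin_assign (Q := fun s' => s' = s.set 1 t 2 0) rfl).seq
        (T₂ := N * (x.time.eval N + 30 + 16) + 12) ?_).mono ?_ fun _ => id
      · rintro _ rfl
        refine hfor.mono le_rfl ?_
        rintro s' ⟨⟨h1, h2⟩, -⟩
        exact ⟨h1, h2⟩
      · simp only [Expr.cost, time, Polynomial.eval_add, Polynomial.eval_mul, Polynomial.eval_X,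
          Polynomial.eval_ofNat]
        have : N * (x.time.eval N + 30 + 16) ≤ N * (x.time.eval N + 60) :=
          Nat.mul_le_mul_left _ (by omega)
        omega
    · rintro i s₁ hi ⟨hf₁, hv₁⟩ hN hvar
      have henv₁ : ∀ k < (env ++ [i]).length, s₁ 1 k 1 = (env ++ [i]).getD k 0 := by
        intro k hk
        rw [List.length_append, List.length_singleton] at hk
        rcases Nat.lt_succ_iff_lt_or_eq.1 hk with h | rfl
        · rw [hf₁ 1 k 1 (by omega), henv k h]
          simp [List.getElem?_append_left h]
        · rw [hvar]; simp
      have hx := ih (env ++ [i]) (t + 1) s₁ (hf₁.rep hs) henv₁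
      rw [List.length_append, List.length_singleton] at hx
      refine hx.seq ?_
      rintro s₂ ⟨hf₂, hv₂⟩
      have e1 : s₂ 1 0 0 = N := by rw [hf₂ 1 0 0 (by omega), hN]
      have e2 : s₂ 1 env.length 1 = i := by rw [hf₂ 1 _ 1 (by omega), hvar]
      have e3 : s₂ 1 t 2 = RAM.best i g := by rw [hf₂ 1 t 2 (by omega), hv₁]
      have e4 : Frame env.length t s s₂ := hf₁.trans (hf₂.mono (by omega) (by omega))
      have hv₂' : s₂ 1 (t + 1) 2 = g i := hv₂
      have keep : better (RAM.best i g) (g i) = RAM.best i g →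
          HaltsWithin .skip s₂ 1 fun s' => (s' 1 0 0 = N ∧ s' 1 env.length 1 = i) ∧
            Frame env.length t s (s'.set 1 env.length 1 (i + 1)) ∧
            (s'.set 1 env.length 1 (i + 1)) 1 t 2 = RAM.best (i + 1) g := fun h =>
        haltsWithin_skip ⟨⟨e1, e2⟩, e4.set_var le_rfl _, by
          simp [Store.set_apply, e3, RAM.best, h]⟩
      have take : better (RAM.best i g) (g i) = g i →
          HaltsWithin (assign t 2 (cell (t + 1) 2)) s₂ 6 fun s' =>
            (s' 1 0 0 = N ∧ s' 1 env.length 1 = i) ∧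
            Frame env.length t s (s'.set 1 env.length 1 (i + 1)) ∧
            (s'.set 1 env.length 1 (i + 1)) 1 t 2 = RAM.best (i + 1) g := fun h =>
        haltsWithin_assign ⟨⟨by simp [Store.set_apply, e1], by simp [Store.set_apply, e2]⟩,
          (e4.set_temp le_rfl _).set_var le_rfl _, by
            simp [Store.set_apply, RAM.best, h, hv₂']⟩
      refine (haltsWithin_branch (T := 20) (fun h1 => ?_) (fun h1 => ?_)).mono
        (by simp) fun _ => id
      · rw [cell_eval, hv₂'] at h1
        refine (haltsWithin_branch (T := 14) (fun h2 => ?_) (fun h2 => ?_)).mono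
          (by simp) fun _ => id
        · rw [cell_eval, e3] at h2
          refine (haltsWithin_branch (T := 6) (fun h3 => ?_) (fun h3 => ?_)).mono
            (by simp [Expr.cost]) fun _ => id
          · simp only [Expr.eval, cell_eval, e3, hv₂'] at h3
            exact take (by rw [better, if_neg h1, if_neg h2, if_pos (by omega)])
          · simp only [Expr.eval, cell_eval, e3, hv₂'] at h3
            exact (keep (by rw [better, if_neg h1, if_neg h2, if_neg (by omega)])).mono
              (by omega) fun _ => id
        · rw [cell_eval, e3] at h2
          exact (take (by rw [better, if_neg h1, if_pos h2])).mono (by omega) fun _ => id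
      · rw [cell_eval, hv₂'] at h1
        exact (keep (by rw [better, if_pos h1])).mono (by omega) fun _ => id

end Term

/-! ### Commands on arrays -/

open Term

/-- The arrays `m` with the first `N` rows and columns of array `a` replaced by `g`. -/
def tabulate (N a : ℕ) (g : ℕ → ℕ → ℕ) (m : Store) : Store :=
  fun a' i j => if a' = a ∧ i < N ∧ j < N then g i j else m a' i j

theorem tabulate_of_ne {N a a' : ℕ} (h : a' ≠ a) (g : ℕ → ℕ → ℕ) (m : Store) :
    tabulate N a g m a' = m a' := by
  funext i j
  simp [tabulate, h]

theorem tabulate_self {N a i j : ℕ} (hi : i < N) (hj : j < N) (g : ℕ → ℕ → ℕ) (m : Store) :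
    tabulate N a g m a i j = g i j := by
  simp [tabulate, hi, hj]

/-- The program `c` transforms the arrays by `F` in time `p`, and does not change the first `d`
loop counters. -/
def Implements (d : ℕ) (c : Prog) (F : ℕ → Store → Store) (p : Polynomial ℕ) : Prop :=
  ∀ N m s, Rep N m s → HaltsWithin c s (p.eval N) fun s' =>
    Rep N (F N m) s' ∧ ∀ k < d, s' 1 k 3 = s 1 k 3

theorem Implements.seq {d : ℕ} {c₁ c₂ : Prog} {F₁ F₂ : ℕ → Store → Store} {p₁ p₂ : Polynomial ℕ}
    (h₁ : Implements d c₁ F₁ p₁) (h₂ : Implements d c₂ F₂ p₂) :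
    Implements d (.seq c₁ c₂) (fun N m => F₂ N (F₁ N m)) (p₁ + p₂) := by
  intro N m s hs
  rw [Polynomial.eval_add]
  refine (h₁ N m s hs).seq ?_
  rintro s₁ ⟨hs₁, hk₁⟩
  refine (h₂ N _ s₁ hs₁).mono le_rfl ?_
  rintro s₂ ⟨hs₂, hk₂⟩
  exact ⟨hs₂, fun k hk => (hk₂ k hk).trans (hk₁ k hk)⟩

/-- The `n`-fold repetition of a command. -/
def repeatProg (d : ℕ) (c : Prog) : Prog := forLoop d 3 c

/-- The counter with number `d` is among the `d + 1` counters that the body leaves alone, so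
repetitions can be nested. -/
theorem Implements.repeat {d : ℕ} {c : Prog} {F : ℕ → Store → Store} {p : Polynomial ℕ}
    (h : Implements (d + 1) c F p) :
    Implements d (repeatProg d c) (fun N => (F N)^[N]) (Polynomial.X * (p + 16) + 12) := by
  intro N m s hs
  refine (haltsWithin_forLoop (N := N) (T := p.eval N)
    (Inv := fun i s' => Rep N ((F N)^[i] m) s' ∧ ∀ k < d, s' 1 k 3 = s 1 k 3)
    (by norm_num) ?_ hs.size ?_).mono (by simp) fun s' h => h.1
  · rintro i s₁ hi ⟨hr, hk⟩ hN hc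
    refine (h N _ s₁ hr).mono le_rfl ?_
    rintro s₂ ⟨hr₂, hk₂⟩
    refine ⟨⟨hr₂.size, by rw [hk₂ d (by omega), hc]⟩, ⟨?_, fun a => ?_⟩, fun k hkd => ?_⟩
    · simp [Store.set_apply, hr₂.size]
    · funext x y
      rw [Function.iterate_succ_apply', ← hr₂.arrays]
      simp [Store.set_apply, phys_ne_one]
    · rw [Store.set_apply, if_neg (by omega), hk₂ k (by omega), hk k hkd]
  · refine ⟨⟨by simp [Store.set_apply, hs.size], fun a => ?_⟩, fun k hk => ?_⟩
    · funext x y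
      rw [Function.iterate_zero_apply, ← hs.arrays]
      simp [Store.set_apply, phys_ne_one]
    · rw [Store.set_apply, if_neg (by omega)]

/-- The program that runs `c` for all values less than the size of variables `0` and `1`. -/
def forPairs (c : Prog) : Prog := forLoop 0 1 (forLoop 1 1 c)

/-- The invariant depends on the set of pairs already treated and must not depend on column `1` of
array `1`, where the two counters live. -/
theorem haltsWithin_forPairs {N T : ℕ} {c : Prog} {Inv : (ℕ → ℕ → Prop) → Store → Prop}
    (hset : ∀ D s r x, Inv D s → Inv D (s.set 1 r 1 x))
    (hbody : ∀ D i j s, i < N → j < N → Inv D s → s 1 0 0 = N → s 1 0 1 = i → s 1 1 1 = j →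
      HaltsWithin c s T fun s' => (s' 1 0 0 = N ∧ s' 1 0 1 = i ∧ s' 1 1 1 = j) ∧
        Inv (fun i' j' => D i' j' ∨ (i' = i ∧ j' = j)) s')
    {s : Store} (hN : s 1 0 0 = N) (h0 : Inv (fun _ _ => False) s) :
    HaltsWithin (forPairs c) s (N * (N * (T + 16) + 28) + 12) fun s' =>
      Inv (fun i j => i < N ∧ j < N) s' := by
  refine (haltsWithin_forLoop (N := N) (T := N * (T + 16) + 12)
    (Inv := fun i s' => Inv (fun i' j' => i' < i ∧ j' < N) s') one_ne_zero ?_ hN ?_).mono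
    le_rfl fun s' h => h.1
  · intro i s₁ hi hinv hN₁ hv₁
    refine (haltsWithin_forLoop (N := N) (T := T)
      (Inv := fun j s' => s' 1 0 1 = i ∧
        Inv (fun i' j' => (i' < i ∧ j' < N) ∨ (i' = i ∧ j' < j)) s')
      one_ne_zero ?_ hN₁ ?_).mono le_rfl ?_
    · rintro j s₂ hj ⟨hv₂, hinv₂⟩ hN₂ hw₂
      refine (hbody _ i j s₂ hi hj hinv₂ hN₂ hv₂ hw₂).mono le_rfl ?_
      rintro s₃ ⟨⟨h1, h2, h3⟩, h4⟩
      refine ⟨⟨h1, h3⟩, by simp [Store.set_apply, h2], hset _ _ _ _ ?_⟩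
      convert h4 using 3
      omega
    · refine ⟨by simp [Store.set_apply, hv₁], hset _ _ _ _ ?_⟩
      convert hinv using 3
      simp
    · rintro s₂ ⟨⟨hv₂, hinv₂⟩, hN₂⟩
      refine ⟨⟨hN₂, hv₂⟩, hset _ _ _ _ ?_⟩
      convert hinv₂ using 3
      omega
  · refine hset _ _ _ _ ?_
    convert h0 using 3
    simp

/-- The program that replaces array `a` by the table of the values of the term `x`. -/
def tabProg (a : ℕ) (x : Term) : Prog :=
  .seq (forPairs (.seq (x.compile 2 0)
      (.write 1 (cell 0 1) (.add (cell 1 1) (.lit 4)) (cell 0 2))))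
    (forPairs (.write (phys a) (cell 0 1) (cell 1 1)
      (.read 1 (cell 0 1) (.add (cell 1 1) (.lit 4)))))

open Polynomial in
-- The term may read the array that it overwrites. So all values are first collected in array `1`,
-- in the columns from `4` on, and copied in a second pass.
theorem implements_tab (d a : ℕ) (x : Term) :
    Implements d (tabProg a x) (fun N m => tabulate N a (fun i j => x.eval N m [i, j]) m)
      (X * (X * (x.time + 50) + 50) + X * (X * 50 + 50) + 30) := by
  intro N m s hs
  refine (HaltsWithin.seq
    (T₁ := N * (N * (x.time.eval N + 12 + 16) + 28) + 12)
    (T₂ := N * (N * (16 + 16) + 28) + 12)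
    (haltsWithin_forPairs (Inv := fun D s' => s' 1 0 0 = N ∧ (∀ a, a ≠ 1 → s' a = s a) ∧
      (∀ k, s' 1 k 3 = s 1 k 3) ∧ ∀ i j, D i j → s' 1 i (j + 4) = x.eval N m [i, j])
      ?_ ?_ hs.size ⟨hs.size, fun _ _ => rfl, fun _ => rfl, fun _ _ => False.elim⟩)
    (fun s₀ hs₀ => haltsWithin_forPairs (Inv := fun D s' => s' 1 0 0 = N ∧
      (∀ a', a' ≠ 1 → a' ≠ phys a → s' a' = s a') ∧
      (∀ k, s' 1 k 3 = s 1 k 3) ∧ (∀ i j, i < N → j < N → s' 1 i (j + 4) = x.eval N m [i, j]) ∧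
      (∀ i j, D i j → s' (phys a) i j = x.eval N m [i, j]) ∧
      (∀ i j, ¬ D i j → s' (phys a) i j = s (phys a) i j)) (s := s₀)
      ?_ ?_ hs₀.1 ⟨hs₀.1, fun a' h _ => hs₀.2.1 a' h, hs₀.2.2.1,
        fun i j hi hj => hs₀.2.2.2 i j ⟨hi, hj⟩, fun _ _ => False.elim,
        fun i j _ => by rw [hs₀.2.1 _ (phys_ne_one a)]⟩)).mono ?_ ?_
  · rintro D s₁ r y ⟨h1, h2, h3, h4⟩
    refine ⟨by simp [Store.set_apply, h1], fun a ha => ?_, fun k => ?_, fun i j hD => ?_⟩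
    · rw [← h2 a ha]
      funext u v
      simp [Store.set_apply, ha]
    · simp [Store.set_apply, h3]
    · simp [Store.set_apply, h4 i j hD]
  · rintro D i j s₁ hi hj ⟨h1, h2, h3, h4⟩ hN hv0 hv1
    have hrep : Rep N m s₁ := ⟨h1, fun a => by rw [h2 _ (phys_ne_one a), hs.arrays]⟩
    have hx := haltsWithin_compile x [i, j] 0 s₁ hrep (by
      intro k hk
      simp only [List.length_cons, List.length_nil] at hk
      rcases (show k = 0 ∨ k = 1 by omega) with rfl | rfl
      · simpa using hv0
      · simpa using hv1)
    refine hx.seq ?_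
    rintro s₂ ⟨hf, hv⟩
    simp only [List.length_cons, List.length_nil] at hf
    have f00 := hf 1 0 0 (by omega)
    have f01 := hf 1 0 1 (by omega)
    have f11 := hf 1 1 1 (by omega)
    refine (haltsWithin_write ?_).mono (by simp [Expr.cost]) fun _ => id
    simp only [Expr.eval, cell_eval, f01, f11, hv0, hv1, hv]
    refine ⟨⟨?_, ?_, ?_⟩, ?_, fun a ha => ?_, fun k => ?_, fun i' j' hD => ?_⟩
    · simp [Store.set_apply, f00, hN]
    · simp [Store.set_apply, f01, hv0]
    · simp [Store.set_apply, f11, hv1]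
    · simp [Store.set_apply, f00, hN]
    · rw [← h2 a ha]
      funext u v
      rw [Store.set_apply, if_neg (by omega), hf a u v (by omega)]
    · rw [Store.set_apply, if_neg (by omega), hf 1 k 3 (by omega), h3]
    · rw [Store.set_apply]
      split_ifs with hc
      · obtain ⟨-, rfl, hj'⟩ := hc
        obtain rfl : j' = j := by omega
        rfl
      · rw [hf 1 i' (j' + 4) (by omega), h4]
        rcases hD with hD | ⟨rfl, rfl⟩
        · exact hD
        · exact (hc ⟨rfl, rfl, rfl⟩).elim
  · rintro D s₁ r y ⟨h1, h2, h3, h4, h5, h6⟩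
    refine ⟨by simp [Store.set_apply, h1], fun a' ha hp => ?_, fun k => ?_, fun i j hi hj => ?_,
      fun i j hD => ?_, fun i j hD => ?_⟩
    · rw [← h2 a' ha hp]
      funext u v
      simp [Store.set_apply, ha]
    · simp [Store.set_apply, h3]
    · simp [Store.set_apply, h4 i j hi hj]
    · simp [Store.set_apply, phys_ne_one, h5 i j hD]
    · simp [Store.set_apply, phys_ne_one, h6 i j hD]
  · rintro D i j s₁ hi hj ⟨h1, h2, h3, h4, h5, h6⟩ hN hv0 hv1
    refine (haltsWithin_write ?_).mono (by simp [Expr.cost]) fun _ => id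
    simp only [Expr.eval, cell_eval, hv0, hv1, h4 i j hi hj]
    have hne := (phys_ne_one a).symm
    refine ⟨⟨?_, ?_, ?_⟩, ?_, fun a' ha hp => ?_, fun k => ?_, fun i' j' hi' hj' => ?_,
      fun i' j' hD => ?_, fun i' j' hD => ?_⟩
    · simp [Store.set_apply, hne, hN]
    · simp [Store.set_apply, hne, hv0]
    · simp [Store.set_apply, hne, hv1]
    · simp [Store.set_apply, hne, hN]
    · rw [← h2 a' ha hp]
      funext u v
      simp [Store.set_apply, hp]
    · simp [Store.set_apply, hne, h3]
    · simp [Store.set_apply, hne, h4 i' j' hi' hj']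
    · rw [Store.set_apply]
      split_ifs with hc
      · obtain ⟨-, rfl, rfl⟩ := hc
        rfl
      · rcases hD with hD | ⟨rfl, rfl⟩
        · exact h5 i' j' hD
        · exact (hc ⟨rfl, rfl, rfl⟩).elim
    · rw [Store.set_apply, if_neg (fun hc => hD (Or.inr hc.2)), h6 i' j' (fun hc => hD (Or.inl hc))]
  · simp only [eval_add, eval_mul, eval_X, eval_ofNat]
    have e1 : N * (N * (x.time.eval N + 12 + 16) + 28) ≤ N * (N * (x.time.eval N + 50) + 50) :=
      Nat.mul_le_mul_left _ (Nat.add_le_add (Nat.mul_le_mul_left _ (by omega)) (by omega))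
    have e2 : N * (N * (16 + 16) + 28) ≤ N * (N * 50 + 50) :=
      Nat.mul_le_mul_left _ (Nat.add_le_add (Nat.mul_le_mul_left _ (by omega)) (by omega))
    omega
  · rintro s' ⟨h1, h2, h3, h4, h5, h6⟩
    refine ⟨⟨h1, fun a' => ?_⟩, fun k _ => h3 k⟩
    funext i j
    change _ = tabulate N a (fun i j => x.eval N m [i, j]) m a' i j
    by_cases ha : a' = a
    · subst ha
      by_cases hij : i < N ∧ j < N
      · rw [h5 i j hij, tabulate_self hij.1 hij.2]
      · rw [h6 i j hij, hs.arrays]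
        simp [tabulate, hij]
    · rw [h2 _ (phys_ne_one a') (fun hc => ha (phys_injective hc)), hs.arrays, tabulate_of_ne ha]

end RAM

namespace RAM

open Term

/-! ### Routines -/

/-- A program together with the transformation of the arrays that it performs. -/
structure Routine where
  prog : Prog
  func : ℕ → Store → Store
  time : Polynomial ℕ
  implements : Implements 0 prog func time

/-- The simultaneous assignment of the values of `x` to the cells of the array `a`. -/
noncomputable def Routine.tab (a : ℕ) (x : Term) : Routine :=
  ⟨_, _, _, implements_tab 0 a x⟩

/-- The `n`-fold repetition of a simultaneous assignment. -/
noncomputable def Routine.iterTab (a : ℕ) (x : Term) : Routine :=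
  ⟨_, _, _, (implements_tab 1 a x).repeat⟩

noncomputable def Routine.seq (r₁ r₂ : Routine) : Routine :=
  ⟨_, _, _, r₁.implements.seq r₂.implements⟩

theorem Routine.seq_func (r₁ r₂ : Routine) (N : ℕ) (m : Store) :
    (r₁.seq r₂).func N m = r₂.func N (r₁.func N m) := rfl

theorem Routine.tab_func_self {a : ℕ} {x : Term} {N : ℕ} {m : Store} {i j : ℕ} (hi : i < N)
    (hj : j < N) : (Routine.tab a x).func N m a i j = x.eval N m [i, j] :=
  tabulate_self hi hj (fun i j => x.eval N m [i, j]) m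

theorem Routine.tab_func_of_ne {a b : ℕ} (h : b ≠ a) {x : Term} {N : ℕ} {m : Store} :
    (Routine.tab a x).func N m b = m b :=
  tabulate_of_ne h _ m

theorem Routine.iterTab_func (a : ℕ) (x : Term) (N : ℕ) (m : Store) :
    (Routine.iterTab a x).func N m = ((Routine.tab a x).func N)^[N] m := rfl

theorem Routine.iterate_tab_of_ne {a b : ℕ} (h : b ≠ a) {x : Term} {N : ℕ} {m : Store} (k : ℕ) :
    (((Routine.tab a x).func N)^[k] m) b = m b := by
  induction k with
  | zero => rfl
  | succ k ih => rw [Function.iterate_succ_apply', Routine.tab_func_of_ne h, ih]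

theorem Routine.iterTab_func_of_ne {a b : ℕ} (h : b ≠ a) {x : Term} {N : ℕ} {m : Store} :
    (Routine.iterTab a x).func N m b = m b :=
  Routine.iterate_tab_of_ne h N

namespace Term

/-- The value of `x` if `a` and `b` are equal, and of `y` otherwise. -/
def ifEq (a b x y : Term) : Term := .ite (.add (.sub a b) (.sub b a)) y x

/-- The value of `x` if `a ≤ b`, and of `y` otherwise. -/
def ifLe (a b x y : Term) : Term := .ite (.sub a b) y x

@[simp]
theorem eval_ifEq (a b x y : Term) (n : ℕ) (m : Store) (env : List ℕ) :
    (ifEq a b x y).eval n m env =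
      if a.eval n m env = b.eval n m env then x.eval n m env else y.eval n m env := by
  simp only [ifEq, eval]
  rw [pick]
  by_cases h : a.eval n m env = b.eval n m env
  · rw [if_pos h, if_neg (by omega)]
  · rw [if_neg h, if_pos (by omega)]

@[simp]
theorem eval_ifLe (a b x y : Term) (n : ℕ) (m : Store) (env : List ℕ) :
    (ifLe a b x y).eval n m env =
      if a.eval n m env ≤ b.eval n m env then x.eval n m env else y.eval n m env := by
  simp only [ifLe, eval]
  rw [pick]
  by_cases h : a.eval n m env ≤ b.eval n m env
  · rw [if_pos h, if_neg (by omega)]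
  · rw [if_neg h, if_pos (by omega)]

end Term

/-! ### Minimization over the vertices -/

section vertices

variable {V : Type*} {n : ℕ}

theorem best_congr {g g' : ℕ → ℕ} (h : ∀ i < n, g i = g' i) : best n g = best n g' := by
  induction n with
  | zero => rfl
  | succ k ih =>
    rw [best, best, ih fun i hi => h i (by omega), h k (by omega)]

theorem exists_best_eq_vertex (e : V ≃ Fin n) {g : ℕ → ℕ} (h : best n g ≠ 0) :
    ∃ v, best n g = g (e v) := by
  obtain ⟨i, hi, he⟩ := exists_best_eq h
  exact ⟨e.symm ⟨i, hi⟩, by simpa using he⟩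

theorem best_vertex (e : V ≃ Fin n) {g : ℕ → ℕ} {v : V} (h : g (e v) ≠ 0) :
    best n g ≠ 0 ∧ best n g ≤ g (e v) :=
  ⟨fun h0 => h (best_eq_zero_iff.1 h0 _ (e v).2), best_le (e v).2 h⟩

theorem val_eq_iff (e : V ≃ Fin n) {u v : V} : (e u : ℕ) = e v ↔ u = v := by
  rw [Fin.val_inj, e.apply_eq_iff_eq]

end vertices

/-! ### All pairs shortest paths -/

section apsp

variable {V : Type*} {n : ℕ}

/-- One round of relaxation of the distances in array `d` for the weights in array `w`. -/
def relaxTerm (w d : ℕ) : Term :=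
  .best (ifEq (.var 2) (.var 0) (.read d (.var 0) (.var 1))
    (.ite (.read w (.var 0) (.var 2))
      (.ite (.read d (.var 2) (.var 1))
        (.sub (.add (.read w (.var 0) (.var 2)) (.read d (.var 2) (.var 1))) (.lit 1)) (.lit 0))
      (.lit 0)))

/-- Computes in array `d` the distances for the weights in array `w`. -/
noncomputable def distances (w d : ℕ) : Routine :=
  (Routine.tab d (ifEq (.var 0) (.var 1) (.lit 1) (.lit 0))).seq
    (Routine.iterTab d (relaxTerm w d))

theorem distances_func_of_ne {w d b : ℕ} (h : b ≠ d) (m : Store) :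
    (distances w d).func n m b = m b := by
  rw [distances, Routine.seq_func, Routine.iterTab_func_of_ne h, Routine.tab_func_of_ne h]

open Classical in
-- After `k` rounds each entry is at most the code of any walk with at most `k` edges, and each
-- nonzero entry is the code of some walk. Paths have fewer than `n` edges, so `n` rounds suffice.
-- Adding two codes counts the shift by one twice, which is why the relaxation subtracts `1`.
theorem distances_spec (e : V ≃ Fin n) {w d : ℕ} (hwd : w ≠ d) {H : SimpleGraph V}
    {ω : V → V → ℕ} {m : Store}
    (hm : ∀ u v, m w (e u) (e v) = if H.Adj u v then ω u v + 1 else 0) :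
    H.IsDistCode ω fun u v => (distances w d).func n m d (e u) (e v) := by
  have : Fintype V := Fintype.ofEquiv _ e.symm
  have hcard : Fintype.card V = n := by rw [Fintype.card_congr e, Fintype.card_fin]
  set m₀ := (Routine.tab d (ifEq (.var 0) (.var 1) (.lit 1) (.lit 0))).func n m with hm₀
  have key : ∀ k,
      (∀ (u v : V) (p : H.Walk u v), p.length ≤ k →
        ((Routine.tab d (relaxTerm w d)).func n)^[k] m₀ d (e u) (e v) ≠ 0 ∧
        ((Routine.tab d (relaxTerm w d)).func n)^[k] m₀ d (e u) (e v) ≤ p.weight ω + 1) ∧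
      (∀ u v : V, ((Routine.tab d (relaxTerm w d)).func n)^[k] m₀ d (e u) (e v) ≠ 0 →
        ∃ p : H.Walk u v, p.weight ω + 1 =
          ((Routine.tab d (relaxTerm w d)).func n)^[k] m₀ d (e u) (e v)) := by
    intro k
    induction k with
    | zero =>
      have hval : ∀ u v : V, m₀ d (e u) (e v) = if u = v then 1 else 0 := by
        intro u v
        rw [hm₀, Routine.tab_func_self (e u).2 (e v).2]
        simp [eval, val_eq_iff]
      simp only [Function.iterate_zero_apply, hval]
      refine ⟨fun u v p hp => ?_, fun u v h => ?_⟩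
      · obtain rfl := p.eq_of_length_eq_zero (by omega)
        simp
      · split_ifs at h ⊢ with huv
        · subst huv
          exact ⟨.nil, by simp⟩
        · simp at h
    | succ k ih =>
      rw [Function.iterate_succ_apply']
      set mk := ((Routine.tab d (relaxTerm w d)).func n)^[k] m₀ with hmk
      obtain ⟨ih1, ih2⟩ := ih
      have hw : ∀ u v, mk w (e u) (e v) = if H.Adj u v then ω u v + 1 else 0 := by
        intro u v
        rw [hmk, Routine.iterate_tab_of_ne hwd, hm₀, Routine.tab_func_of_ne hwd, hm]
      set g : V → V → ℕ → ℕ := fun u v x => if x = (e u : ℕ) then mk d (e u) (e v) else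
        if mk w (e u) x ≠ 0 then if mk d x (e v) ≠ 0 then mk w (e u) x + mk d x (e v) - 1 else 0
        else 0 with hg
      have hval : ∀ u v : V, (Routine.tab d (relaxTerm w d)).func n mk d (e u) (e v) =
          best n (g u v) := by
        intro u v
        rw [Routine.tab_func_self (e u).2 (e v).2]
        simp [relaxTerm, eval, pick, hg]
      have hg1 : ∀ u v, g u v (e u) = mk d (e u) (e v) := by
        intro u v
        simp [hg]
      have hg2 : ∀ u v x, H.Adj u x → mk d (e x) (e v) ≠ 0 →
          g u v (e x) = ω u x + mk d (e x) (e v) := by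
        intro u v x hux hx
        have hne : (e x : ℕ) ≠ e u := fun h => hux.ne ((val_eq_iff e).1 h).symm
        simp only [hg, hw, if_pos hux, if_neg hne, if_pos hx]
        rw [if_pos (by omega)]
        omega
      refine ⟨fun u v p hp => ?_, fun u v h => ?_⟩
      · rw [hval]
        cases p with
        | nil =>
          obtain ⟨h1, h2⟩ := ih1 u u .nil (by simp)
          rw [← hg1] at h1 h2
          exact ⟨(best_vertex e h1).1, (best_vertex e h1).2.trans h2⟩
        | @cons _ x _ ha q =>
          rw [SimpleGraph.Walk.length_cons] at hp
          obtain ⟨h1, h2⟩ := ih1 x v q (by omega)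
          have h3 := hg2 u v x ha h1
          obtain ⟨h4, h5⟩ := best_vertex e (g := g u v) (v := x) (by omega)
          refine ⟨h4, ?_⟩
          rw [SimpleGraph.Walk.weight_cons]
          omega
      · rw [hval] at h ⊢
        obtain ⟨x, hx⟩ := exists_best_eq_vertex e h
        rw [hx] at h ⊢
        by_cases hxu : x = u
        · subst hxu
          rw [hg1] at h ⊢
          exact ih2 _ _ h
        · have hne : (e x : ℕ) ≠ e u := fun h => hxu ((val_eq_iff e).1 h)
          have h' := h
          simp only [hg, if_neg hne, hw] at h'
          by_cases hux : H.Adj u x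
          · by_cases hd : mk d (e x) (e v) = 0
            · simp [hd] at h'
            · rw [hg2 u v x hux hd]
              obtain ⟨p, hp⟩ := ih2 x v hd
              exact ⟨.cons hux p, by rw [SimpleGraph.Walk.weight_cons, ← hp]; ring⟩
          · simp [hux] at h'
  obtain ⟨h1, h2⟩ := key n
  have hlen : ∀ {u v : V} (p : H.Walk u v), ∃ q : H.Walk u v, q.length ≤ n ∧
      q.weight ω ≤ p.weight ω := by
    intro u v p
    obtain ⟨q, hq, hw⟩ := p.exists_isPath_weight_le ω
    exact ⟨q, by have := hq.length_lt; omega, hw⟩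
  refine ⟨fun p => ?_, fun p => ?_, fun h => h2 _ _ h⟩
  · obtain ⟨q, hq, -⟩ := hlen p
    exact (h1 _ _ q hq).1
  · obtain ⟨q, hq, hw⟩ := hlen p
    exact (h1 _ _ q hq).2.trans (by omega)

theorem _root_.SimpleGraph.IsDistCode.eq_dist_add_one {G : SimpleGraph V} {ρ : V → V → ℕ}
    (h : G.IsDistCode (fun _ _ => 1) ρ) {u v : V} (huv : G.Reachable u v) :
    ρ u v = G.dist u v + 1 := by
  have hw : ∀ {a b : V} (p : G.Walk a b), p.weight (fun _ _ => 1) = p.length := by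
    intro a b p
    simp [SimpleGraph.Walk.weight]
  obtain ⟨p, hp⟩ := huv.exists_walk_length_eq_dist
  obtain ⟨q, hq⟩ := h.exists_walk (h.ne_zero_iff.2 huv)
  have h1 := h.le p
  have h2 := G.dist_le q
  rw [hw] at h1 hq
  omega

end apsp

/-! ### Layers -/

section layers

variable {V : Type*} {n : ℕ}

/-- Computes the distances in array `3` and the layers in array `4`. -/
noncomputable def layers : Routine :=
  (((Routine.tab 5 (.add (.read 0 (.var 0) (.var 1)) (.read 0 (.var 0) (.var 1)))).seq
    (distances 5 3)).seq
    (Routine.tab 5 (.best (.ite (.read 3 (.var 2) (.var 0)) (.add (.var 2) (.lit 1))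
      (.lit 0))))).seq
    (Routine.tab 4 (.sub (.read 3 (.sub (.read 5 (.var 0) (.lit 0)) (.lit 1)) (.var 0)) (.lit 1)))

theorem layers_func_of_ne {b : ℕ} (h3 : b ≠ 3) (h4 : b ≠ 4) (h5 : b ≠ 5) (m : Store) :
    layers.func n m b = m b := by
  rw [layers, Routine.seq_func, Routine.tab_func_of_ne h4, Routine.seq_func,
    Routine.tab_func_of_ne h5, Routine.seq_func, distances_func_of_ne h3, Routine.tab_func_of_ne h5]

open Classical in
-- Doubling the adjacency matrix gives the code `2` of weight `1`. The root of `v` is the vertex of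
-- least number that reaches `v`, hence the same throughout a component.
theorem layers_spec (e : V ≃ Fin n) {G : SimpleGraph V} {m : Store}
    (hm : ∀ u v, m 0 (e u) (e v) = if G.Adj u v then 1 else 0) :
    G.IsDistCode (fun _ _ => 1) (fun u v => layers.func n m 3 (e u) (e v)) ∧
      ∃ r, G.IsLayering r fun v => layers.func n m 4 (e v) 0 := by
  set m₀ := (Routine.tab 5 (.add (.read 0 (.var 0) (.var 1))
    (.read 0 (.var 0) (.var 1)))).func n m with hm₀
  have h0 : ∀ u v, m₀ 5 (e u) (e v) = if G.Adj u v then 1 + 1 else 0 := by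
    intro u v
    rw [hm₀, Routine.tab_func_self (e u).2 (e v).2]
    simp only [eval, List.getD_cons_zero, List.getD_cons_succ, hm]
    split_ifs <;> rfl
  set m₁ := (distances 5 3).func n m₀ with hm₁
  have hd : G.IsDistCode (fun _ _ => 1) (fun u v => m₁ 3 (e u) (e v)) :=
    distances_spec e (by norm_num) h0
  set m₂ := (Routine.tab 5 (.best (.ite (.read 3 (.var 2) (.var 0)) (.add (.var 2) (.lit 1))
    (.lit 0)))).func n m₁ with hm₂
  have e3 : m₂ 3 = m₁ 3 := Routine.tab_func_of_ne (by norm_num)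
  have e3' : layers.func n m 3 = m₁ 3 := by
    rw [← e3, layers, Routine.seq_func, Routine.tab_func_of_ne (by norm_num)]
    rfl
  refine ⟨by simpa only [e3'] using hd, ?_⟩
  set g : V → ℕ → ℕ := fun v i => if m₁ 3 i (e v) ≠ 0 then i + 1 else 0 with hg
  have hroot : ∀ v, m₂ 5 (e v) 0 = best n (g v) := by
    intro v
    rw [hm₂, Routine.tab_func_self (e v).2 (Nat.zero_lt_of_lt (e v).2)]
    simp [eval, pick, hg]
  have hlev : ∀ v, layers.func n m 4 (e v) 0 = m₁ 3 (best n (g v) - 1) (e v) - 1 := by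
    intro v
    rw [← hroot, ← e3]
    exact Routine.tab_func_self (e v).2 (Nat.zero_lt_of_lt (e v).2)
  have hne : ∀ v, best n (g v) ≠ 0 := by
    intro v
    refine (best_vertex e (v := v) ?_).1
    simp only [hg]
    rw [if_pos (hd.ne_zero SimpleGraph.Walk.nil)]
    omega
  choose r hr using fun v => exists_best_eq_vertex e (hne v)
  have hr1 : ∀ v, m₁ 3 (e (r v)) (e v) ≠ 0 ∧ best n (g v) = e (r v) + 1 := by
    intro v
    have h1 := hr v
    have h2 := hne v
    simp only [hg] at h1 h2
    split_ifs at h1 with h3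
    · exact ⟨h3, h1⟩
    · exact (h2 h1).elim
  refine ⟨r, fun v => hd.ne_zero_iff.1 (hr1 v).1, fun u v huv => ?_, fun v => ?_⟩
  · have : best n (g u) = best n (g v) := by
      refine best_congr fun i hi => ?_
      have hi' : (e (e.symm ⟨i, hi⟩) : ℕ) = i := by simp
      have h1 := hd.ne_zero_iff (u := e.symm ⟨i, hi⟩) (v := u)
      have h2 := hd.ne_zero_iff (u := e.symm ⟨i, hi⟩) (v := v)
      simp only [hi'] at h1 h2
      simp only [hg, h1, h2]
      have : G.Reachable (e.symm ⟨i, hi⟩) u ↔ G.Reachable (e.symm ⟨i, hi⟩) v :=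
        ⟨fun h => h.trans huv, fun h => h.trans huv.symm⟩
      simp [this]
    rw [(hr1 u).2, (hr1 v).2] at this
    exact (val_eq_iff e).1 (by omega)
  · have := hd.eq_dist_add_one (hd.ne_zero_iff.1 (hr1 v).1)
    rw [hlev, (hr1 v).2, Nat.add_sub_cancel, this, Nat.add_sub_cancel]

theorem _root_.SimpleGraph.IsLayering.level_lt {G : SimpleGraph V} {r : V → V} {level : V → ℕ}
    (h : G.IsLayering r level) (e : V ≃ Fin n) (v : V) : level v < n := by
  have : Fintype V := Fintype.ofEquiv _ e.symm
  have hcard : Fintype.card V = n := by rw [Fintype.card_congr e, Fintype.card_fin]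
  obtain ⟨p, hp, hl⟩ := (h.reachable v).exists_path_of_dist
  rw [h.level_eq, ← hl, ← hcard]
  exact hp.length_lt

end layers

/-! ### The input -/

section input

variable {V : Type*} {n : ℕ}

theorem rep_input (e : V ≃ Fin n) (G : SimpleGraph V) (x : ℕ → ℕ) :
    Rep n (fun a => input e G x (phys a)) (input e G x) :=
  ⟨rfl, fun _ => rfl⟩

open Classical in
theorem input_adj (e : V ≃ Fin n) (G : SimpleGraph V) (x : ℕ → ℕ) (u v : V) :
    input e G x (phys 0) (e u) (e v) = if G.Adj u v then 1 else 0 := by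
  have : (∃ u' v', G.Adj u' v' ∧ (e u' : ℕ) = e u ∧ (e v' : ℕ) = e v) ↔ G.Adj u v := by
    constructor
    · rintro ⟨u', v', h, h1, h2⟩
      rw [val_eq_iff] at h1 h2
      rwa [← h1, ← h2]
    · exact fun h => ⟨u, v, h, rfl, rfl⟩
  simp only [phys, input, this, if_true]

theorem input_param (e : V ≃ Fin n) (G : SimpleGraph V) (x : ℕ → ℕ) (i : ℕ) :
    input e G x (phys 1) i 0 = x i := rfl

theorem Routine.haltsWithin (R : Routine) (e : V ≃ Fin n) (G : SimpleGraph V) (x : ℕ → ℕ)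
    {Q : Store → Prop}
    (h : ∀ s, (∀ a, s (phys a) = R.func n (fun a => input e G x (phys a)) a) → Q s) :
    HaltsWithin R.prog (input e G x) (R.time.eval n) Q :=
  (R.implements n _ _ (rep_input e G x)).mono le_rfl fun s hs => h s hs.1.arrays

end input

/-! ### The scattering algorithm -/

section scattering

variable {V : Type*} {n : ℕ}

/-- One round of the computation of the quotients by `(Δ - 1) / 2` in array `6`. -/
def bandTerm : Term :=
  ifLe (.add (.add (.var 0) (.var 0)) (.lit 3)) (.read 1 (.lit 0) (.lit 0)) (.lit 0)
    (.add (.lit 1) (.read 6 (.sub (.var 0) (.sub (.best (ifLe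
      (.add (.add (.var 2) (.var 2)) (.lit 3)) (.read 1 (.lit 0) (.lit 0)) (.lit 0)
      (.add (.var 2) (.lit 1)))) (.lit 1))) (.lit 0)))

/-- The table of the quotients by `(Δ - 1) / 2`, where `Δ` is the parameter, in array `6`. -/
noncomputable def bandTable : Routine := Routine.iterTab 6 bandTerm

/-- Without division, `l < w` is tested as `2 * l + 3 ≤ Δ`, the width itself is found as the least
`i` failing this test, and the quotient follows from `l / w = 1 + (l - w) / w`. Round `k` makes the
entries below `k` correct. -/
theorem bandTable_spec {m : Store} {w : ℕ} (hw : w = (m 1 0 0 - 1) / 2) (hw0 : w ≠ 0) {l : ℕ}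
    (hl : l < n) : bandTable.func n m 6 l 0 = l / w := by
  rw [bandTable, Routine.iterTab_func]
  have key : ∀ k l, l < n → l < k → (((Routine.tab 6 bandTerm).func n)^[k] m) 6 l 0 = l / w := by
    intro k
    induction k with
    | zero => intro l _ h; omega
    | succ k ih =>
      intro l hl hlk
      rw [Function.iterate_succ_apply', Routine.tab_func_self hl (Nat.zero_lt_of_lt hl)]
      set mk := ((Routine.tab 6 bandTerm).func n)^[k] m with hmk
      have h1 : mk 1 = m 1 := Routine.iterate_tab_of_ne (by norm_num) k
      simp only [bandTerm, eval_ifLe, eval, h1, List.getD_cons_zero, List.cons_append,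
        List.nil_append,
        List.getD_cons_succ]
      by_cases hlw : l < w
      · rw [if_pos (by omega), Nat.div_eq_of_lt hlw]
      · rw [if_neg (by omega)]
        set g : ℕ → ℕ := fun i => if i + i + 3 ≤ m 1 0 0 then 0 else i + 1 with hg
        have hgw : g w = w + 1 := by
          simp only [hg]
          rw [if_neg (by omega)]
        have hle := best_le (n := n) (g := g) (i := w) (by omega) (by omega)
        have hbest : best n g = w + 1 := by
          obtain ⟨i, hi, he⟩ := exists_best_eq (n := n) (g := g)
            (fun h0 => by have := best_eq_zero_iff.1 h0 w (by omega); omega)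
          have hne : best n g ≠ 0 := fun h0 => by
            have := best_eq_zero_iff.1 h0 w (by omega); omega
          have he' : best n g = if i + i + 3 ≤ m 1 0 0 then 0 else i + 1 := he
          split_ifs at he' <;> omega
        rw [hbest, Nat.add_sub_cancel, ih (l - w) (by omega) (by omega)]
        have := Nat.add_div_right (l - w) (Nat.pos_of_ne_zero hw0)
        rw [Nat.sub_add_cancel (by omega)] at this
        omega
  exact key n l hl hl

/-- The algorithm for scattering partitions. -/
noncomputable def scattering : Routine :=
  (((layers.seq bandTable).seq
    (Routine.tab 7 (.ite (.read 0 (.var 0) (.var 1))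
      (ifLe (.read 1 (.lit 0) (.lit 0)) (.lit 2) (.lit 0)
        (ifEq (.read 6 (.read 4 (.var 0) (.lit 0)) (.lit 0))
          (.read 6 (.read 4 (.var 1) (.lit 0)) (.lit 0)) (.lit 1) (.lit 0))) (.lit 0)))).seq
    (distances 7 8)).seq
    (Routine.tab 2 (.best (.ite (.read 8 (.var 2) (.var 0)) (.add (.var 2) (.lit 1)) (.lit 0))))

/-- With all edge weights zero, the shortest path routine decides reachability in the band graph,
and the least number in a component serves as the label of its cluster. The test `Δ ≤ 2` detects
width zero, for which the quotient table is meaningless. -/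
theorem scattering_spec (e : V ≃ Fin n) {G : SimpleGraph V} (hG : G.IsChordal) {Δ : ℝ}
    (hΔ : 0 < Δ) {s : Store}
    (hs : ∀ a, s (phys a) = scattering.func n (fun a => input e G
      (fun i => if i = 0 then ⌊Δ⌋₊ else 0) (phys a)) a) :
    G.IsScatteringPartition 2 3 Δ (outputPartition e s) := by
  classical
  set x : ℕ → ℕ := fun i => if i = 0 then ⌊Δ⌋₊ else 0 with hx
  set m₀ : Store := fun a => input e G x (phys a) with hm₀
  set w := (⌊Δ⌋₊ - 1) / 2 with hw
  have hadj : ∀ u v, m₀ 0 (e u) (e v) = if G.Adj u v then 1 else 0 := input_adj e G x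
  have hpar : m₀ 1 0 0 = ⌊Δ⌋₊ := by rw [hm₀]; simp [input_param, hx]
  set m₁ := layers.func n m₀ with hm₁
  obtain ⟨-, r, hlay⟩ := layers_spec e hadj
  rw [← hm₁] at hlay
  set m₂ := bandTable.func n m₁ with hm₂
  have h10 : m₁ 0 = m₀ 0 := layers_func_of_ne (by norm_num) (by norm_num) (by norm_num) _
  have h11 : m₁ 1 = m₀ 1 := layers_func_of_ne (by norm_num) (by norm_num) (by norm_num) _
  have h2 : ∀ b, b ≠ 6 → m₂ b = m₁ b := fun b hb => Routine.iterTab_func_of_ne hb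
  have hband : w ≠ 0 → ∀ l < n, m₂ 6 l 0 = l / w := fun hw0 l hl =>
    bandTable_spec (by rw [h11, hpar]) hw0 hl
  set level : V → ℕ := fun v => m₁ 4 (e v) 0 with hlevel
  set m₃ := (Routine.tab 7 (.ite (.read 0 (.var 0) (.var 1))
      (ifLe (.read 1 (.lit 0) (.lit 0)) (.lit 2) (.lit 0)
        (ifEq (.read 6 (.read 4 (.var 0) (.lit 0)) (.lit 0))
          (.read 6 (.read 4 (.var 1) (.lit 0)) (.lit 0)) (.lit 1) (.lit 0))) (.lit 0))).func n m₂
    with hm₃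
  have h3 : ∀ u v, m₃ 7 (e u) (e v) = if (G.bandGraph level w).Adj u v then 0 + 1 else 0 := by
    intro u v
    rw [hm₃, Routine.tab_func_self (e u).2 (e v).2]
    simp only [eval, pick, eval_ifLe, eval_ifEq, List.getD_cons_zero, List.getD_cons_succ,
      h2 0 (by norm_num), h2 1 (by norm_num), h2 4 (by norm_num), h10, h11, hpar, hadj]
    have hiff : (G.bandGraph level w).Adj u v ↔ G.Adj u v ∧ w ≠ 0 ∧ level u / w = level v / w :=
      Iff.rfl
    rw [hiff]
    by_cases huv : G.Adj u v
    · by_cases hw0 : w = 0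
      · have h2Δ : ⌊Δ⌋₊ ≤ 2 := by omega
        simp [huv, hw0, h2Δ]
      · have h2Δ : ¬ ⌊Δ⌋₊ ≤ 2 := by omega
        have e1 := hband hw0 (level u) (hlay.level_lt e u)
        have e2 := hband hw0 (level v) (hlay.level_lt e v)
        simp only [hlevel] at e1 e2 ⊢
        rw [e1, e2]
        simp [huv, hw0, h2Δ]
    · simp [huv]
  set m₄ := (distances 7 8).func n m₃ with hm₄
  have hρ : (G.bandGraph level w).IsDistCode (fun _ _ => 0) fun u v => m₄ 8 (e u) (e v) :=
    distances_spec e (by norm_num) h3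
  set g : V → ℕ → ℕ := fun v i => if m₄ 8 i (e v) ≠ 0 then i + 1 else 0 with hg
  have hlab : ∀ v, s 3 (e v) 0 = best n (g v) := by
    intro v
    -- Array `2` of the terms is array `3` of the machine, since `phys 2 = 3`.
    have : s 3 = _ := hs 2
    rw [this]
    refine (Routine.tab_func_self (e v).2 (Nat.zero_lt_of_lt (e v).2)).trans ?_
    simp only [eval, pick, hg, List.getD_cons_zero, List.cons_append, List.nil_append,
        List.getD_cons_succ]
    rfl
  have hsame : ∀ u v, s 3 (e u) 0 = s 3 (e v) 0 ↔ (G.bandGraph level w).Reachable u v := by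
    intro u v
    rw [hlab, hlab]
    constructor
    · intro huv
      have hex : ∀ v, ∃ z, (G.bandGraph level w).Reachable z v ∧ best n (g v) = e z + 1 := by
        intro v
        have hne : best n (g v) ≠ 0 := by
          refine (best_vertex e (v := v) ?_).1
          simp only [hg]
          rw [if_pos (hρ.ne_zero SimpleGraph.Walk.nil)]
          omega
        obtain ⟨z, hz⟩ := exists_best_eq_vertex e hne
        rw [hz] at hne ⊢
        simp only [hg] at hne ⊢
        split_ifs at hne ⊢ with hc
        · exact ⟨z, hρ.ne_zero_iff.1 hc, rfl⟩
        · exact (hne rfl).elim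
      obtain ⟨a, ha, ha'⟩ := hex u
      obtain ⟨b, hb, hb'⟩ := hex v
      obtain rfl : a = b := (val_eq_iff e).1 (by omega)
      exact ha.symm.trans hb
    · intro huv
      refine best_congr fun i hi => ?_
      have hi' : (e (e.symm ⟨i, hi⟩) : ℕ) = i := by simp
      have h1 := hρ.ne_zero_iff (u := e.symm ⟨i, hi⟩) (v := u)
      have h2 := hρ.ne_zero_iff (u := e.symm ⟨i, hi⟩) (v := v)
      simp only [hi'] at h1 h2
      simp only [hg, h1, h2]
      have : (G.bandGraph level w).Reachable (e.symm ⟨i, hi⟩) u ↔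
          (G.bandGraph level w).Reachable (e.symm ⟨i, hi⟩) v :=
        ⟨fun h => h.trans huv, fun h => h.trans huv.symm⟩
      simp [this]
  have := hlay.isScatteringPartition hG hΔ
  unfold outputPartition
  simp only [hsame]
  exact this

end scattering

end RAM

namespace RAM

open Term SimpleGraph

/-! ### The algorithm for Steiner point removal -/

section steiner

variable {V : Type*} {n : ℕ}

/-- One round of the computation of the table of the numbers `16 * twoPart l` in array `7`. -/
def twoPartTerm : Term :=
  .ite (.best (ifEq (.add (.var 2) (.var 2)) (.var 0)
      (.add (.read 7 (.var 2) (.lit 0)) (.read 7 (.var 2) (.lit 0))) (.lit 0)))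
    (.best (ifEq (.add (.var 2) (.var 2)) (.var 0)
      (.add (.read 7 (.var 2) (.lit 0)) (.read 7 (.var 2) (.lit 0))) (.lit 0))) (.lit 16)

/-- Computes the table of the numbers `16 * twoPart l` in array `7`. -/
noncomputable def twoPartTable : Routine := Routine.iterTab 7 twoPartTerm

theorem twoPart_two_mul {l : ℕ} (hl : l ≠ 0) : twoPart (l + l) = 2 * twoPart l := by
  have : Fact (Nat.Prime 2) := ⟨Nat.prime_two⟩
  rw [← two_mul, twoPart, twoPart, padicValNat.mul two_ne_zero hl, padicValNat_self, pow_add,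
    pow_one]

theorem twoPart_of_odd {l : ℕ} (hl : ¬ 2 ∣ l) : twoPart l = 1 := by
  rw [twoPart, padicValNat.eq_zero_of_not_dvd hl, pow_zero]

/-- An even entry is twice the entry at its half, which is smaller and hence already correct; an odd
entry is `16`. Entry `0` is never needed, because the deeper end of an edge between different layers
has positive level. -/
theorem twoPartTable_spec {m : Store} {l : ℕ} (hl : l < n) (hl0 : l ≠ 0) :
    twoPartTable.func n m 7 l 0 = 16 * twoPart l := by
  rw [twoPartTable, Routine.iterTab_func]
  have key : ∀ k l, l < n → l ≠ 0 → l ≤ k →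
      (((Routine.tab 7 twoPartTerm).func n)^[k] m) 7 l 0 = 16 * twoPart l := by
    intro k
    induction k with
    | zero => intro l _ h0 h; omega
    | succ k ih =>
      intro l hl hl0 hlk
      rw [Function.iterate_succ_apply', Routine.tab_func_self hl (Nat.zero_lt_of_lt hl)]
      set mk := ((Routine.tab 7 twoPartTerm).func n)^[k] m with hmk
      simp only [twoPartTerm, eval_ifEq, eval, List.getD_cons_zero, List.cons_append,
        List.nil_append, List.getD_cons_succ]
      set g : ℕ → ℕ := fun i => if i + i = l then mk 7 i 0 + mk 7 i 0 else 0 with hg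
      have hgi : ∀ i, g i = if i + i = l then mk 7 i 0 + mk 7 i 0 else 0 := fun i => rfl
      by_cases h2 : 2 ∣ l
      · obtain ⟨i, rfl⟩ := h2
        have hi := ih i (by omega) (by omega) (by omega)
        have hgv : g i = 16 * twoPart (2 * i) := by
          rw [hgi, if_pos (by omega), hi, two_mul i, twoPart_two_mul (by omega)]
          ring
        have hpos := twoPart_pos (2 * i)
        have hne : best n g ≠ 0 := fun h0 => by
          have := best_eq_zero_iff.1 h0 i (by omega)
          omega
        have hb : best n g = 16 * twoPart (2 * i) := by
          obtain ⟨j, hj, he⟩ := exists_best_eq hne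
          have hj' := he
          rw [hgi] at hj'
          split_ifs at hj' with hc
          · obtain rfl : j = i := by omega
            rw [he, hgv]
          · exact (hne hj').elim
        rw [pick, if_pos hne, hb]
      · have hz : best n g = 0 := by
          rw [best_eq_zero_iff]
          intro i _
          rw [hgi, if_neg (by omega)]
        rw [pick, if_neg (by simpa using hz), twoPart_of_odd h2]
  exact key n l hl hl0 hl.le

/-- The best value of `ρ t v` over the terminals `t`, for distances `ρ` in array `d`. -/
def nearestTerm (d : ℕ) : Term :=
  .best (.ite (.read 1 (.var 2) (.lit 0)) (.read d (.var 2) (.var 0)) (.lit 0))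

/-- The codes of the detour weights. -/
def detourTerm : Term :=
  .ite (.read 0 (.var 0) (.var 1))
    (ifLe (.add (.read 6 (.var 0) (.lit 0)) (.read 6 (.var 1) (.lit 0)))
      (ifEq (.read 4 (.var 0) (.lit 0)) (.read 4 (.var 1) (.lit 0)) (.lit 16)
        (.read 7 (.add (.read 4 (.var 0) (.lit 0))
          (.sub (.read 4 (.var 1) (.lit 0)) (.read 4 (.var 0) (.lit 0)))) (.lit 0)))
      (.add (.add (.read 6 (.var 0) (.lit 0)) (.read 6 (.var 1) (.lit 0))) (.lit 1)) (.lit 1))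
    (.lit 0)

/-- The label of the Voronoi cell. -/
def labelTerm : Term :=
  .best (.ite (.read 1 (.var 2) (.lit 0)) (.ite (.read 9 (.var 2) (.var 0))
    (ifEq (.read 9 (.var 2) (.var 0)) (.read 10 (.var 0) (.lit 0)) (.add (.var 2) (.lit 1))
      (.lit 0)) (.lit 0)) (.lit 0))

/-- The weighted adjacency matrix of the minor. -/
def minorTerm : Term :=
  ifEq (.var 0) (.var 1) (.lit 0)
    (.ite (.best (.best (.ite (.read 0 (.var 2) (.var 3))
        (ifEq (.read 11 (.var 2) (.lit 0)) (.add (.var 0) (.lit 1))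
          (ifEq (.read 11 (.var 3) (.lit 0)) (.add (.var 1) (.lit 1)) (.lit 1) (.lit 0)) (.lit 0))
        (.lit 0))))
      (.sub (.read 3 (.var 0) (.var 1)) (.lit 1)) (.lit 0))

/-- The algorithm for Steiner point removal. -/
noncomputable def steiner : Routine :=
  (((((((layers.seq (Routine.tab 6 (nearestTerm 3))).seq twoPartTable).seq
    (Routine.tab 8 detourTerm)).seq (distances 8 9)).seq (Routine.tab 10 (nearestTerm 9))).seq
    (Routine.tab 11 labelTerm)).seq (Routine.tab 2 minorTerm))

theorem nearestTerm_eval {d : ℕ} {m : Store} (i j : ℕ) :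
    (nearestTerm d).eval n m [i, j] = best n fun t => if m 1 t 0 ≠ 0 then m d t i else 0 := by
  simp only [nearestTerm, eval, pick, List.getD_cons_zero, List.cons_append, List.nil_append,
    List.getD_cons_succ]

theorem indicator_ne_zero_iff (e : V ≃ Fin n) {K : Set V} {v : V} :
    indicator e K (e v) ≠ 0 ↔ v ∈ K := by
  classical
  have : (∃ u ∈ K, (e u : ℕ) = e v) ↔ v ∈ K := by
    constructor
    · rintro ⟨u, hu, huv⟩
      rwa [← (val_eq_iff e).1 huv]
    · exact fun h => ⟨v, h, rfl⟩
  simp [indicator, this]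

/-- The minimum over the terminals, as computed by `nearestTerm`. -/
theorem nearest_spec (e : V ≃ Fin n) {K : Set V} {m : Store} {d : ℕ}
    (hK : ∀ v, m 1 (e v) 0 ≠ 0 ↔ v ∈ K) (v : V) :
    (∀ t ∈ K, m d (e t) (e v) ≠ 0 → (nearestTerm d).eval n m [e v, 0] ≠ 0 ∧
      (nearestTerm d).eval n m [e v, 0] ≤ m d (e t) (e v)) ∧
    ((nearestTerm d).eval n m [e v, 0] ≠ 0 →
      ∃ t ∈ K, (nearestTerm d).eval n m [e v, 0] = m d (e t) (e v)) := by
  rw [nearestTerm_eval]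
  set g : ℕ → ℕ := fun t => if m 1 t 0 ≠ 0 then m d t (e v) else 0 with hg
  refine ⟨fun t ht h => ?_, fun h => ?_⟩
  · have hgt : g (e t) = m d (e t) (e v) := if_pos ((hK t).2 ht)
    rw [← hgt] at h ⊢
    exact best_vertex e h
  · obtain ⟨t, ht⟩ := exists_best_eq_vertex e h
    have ht' := ht
    simp only [hg, hK] at ht'
    by_cases htK : t ∈ K
    · exact ⟨t, htK, by rw [ht]; exact if_pos ((hK t).2 htK)⟩
    · exact (h (by rw [ht]; exact if_neg (fun hc => htK ((hK t).1 hc)))).elim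

theorem isTerminalDistCode_of_nearest (e : V ≃ Fin n) {G : SimpleGraph V} {K : Set V} {m : Store}
    (hK : ∀ v, m 1 (e v) 0 ≠ 0 ↔ v ∈ K)
    (hd : G.IsDistCode (fun _ _ => 1) (fun u v => m 3 (e u) (e v))) :
    G.IsTerminalDistCode K fun v => (nearestTerm 3).eval n m [e v, 0] := by
  refine ⟨fun t ht v htv => ?_, fun t ht v htv => ?_, fun v hv => ?_⟩
  · exact ((nearest_spec e hK v).1 t ht (hd.ne_zero_iff.2 htv)).1
  · rw [← hd.eq_dist_add_one htv]
    exact ((nearest_spec e hK v).1 t ht (hd.ne_zero_iff.2 htv)).2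
  · obtain ⟨t, ht, he⟩ := (nearest_spec e hK v).2 hv
    have htv : G.Reachable t v := hd.ne_zero_iff.1 (by rw [he] at hv; exact hv)
    exact ⟨t, ht, htv, by rw [he, hd.eq_dist_add_one htv]⟩

/-- Among the terminals attaining the minimum in array `10`, the bounded minimum selects the one of
least number, which is the tie-breaking rule of `IsNearest`. -/
theorem labelTerm_eval_eq_iff (e : V ≃ Fin n) {K : Set V} {m : Store}
    (hK : ∀ v, m 1 (e v) 0 ≠ 0 ↔ v ∈ K)
    (h10 : ∀ v, m 10 (e v) 0 = (nearestTerm 9).eval n m [e v, 0]) (t v : V) :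
    labelTerm.eval n m [e v, 0] = e t + 1 ↔
      IsNearest K (fun u v => m 9 (e u) (e v)) (fun v => (e v : ℕ)) t v := by
  set g : ℕ → ℕ := fun t => if m 1 t 0 ≠ 0 then if m 9 t (e v) ≠ 0 then
    if m 9 t (e v) = m 10 (e v) 0 then t + 1 else 0 else 0 else 0 with hg
  have hlab : labelTerm.eval n m [e v, 0] = best n g := by
    simp only [labelTerm, eval, pick, eval_ifEq, List.getD_cons_zero, List.cons_append,
      List.nil_append, List.getD_cons_succ, hg]
  rw [hlab]
  have hgne : ∀ s : V, g (e s) ≠ 0 →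
      s ∈ K ∧ m 9 (e s) (e v) ≠ 0 ∧ m 9 (e s) (e v) = m 10 (e v) 0 ∧ g (e s) = e s + 1 := by
    intro s hs
    have hs' := hs
    simp only [hg] at hs' ⊢
    split_ifs at hs' ⊢ with h1 h2 h3
    · exact ⟨(hK s).1 h1, h2, h3, rfl⟩
    · exact (hs' rfl).elim
    · exact (hs' rfl).elim
    · exact (hs' rfl).elim
  obtain ⟨hn1, hn2⟩ := nearest_spec (d := 9) e hK v
  rw [← h10] at hn1 hn2
  have back : ∀ t, IsNearest K (fun u v => m 9 (e u) (e v)) (fun v => (e v : ℕ)) t v →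
      best n g = e t + 1 := by
    intro t ht
    have hmin : m 9 (e t) (e v) = m 10 (e v) 0 := by
      obtain ⟨h1, h2⟩ := hn1 t ht.mem ht.ne_zero
      obtain ⟨s, hs, he⟩ := hn2 h1
      rw [he] at h1 h2
      have := ht.le s hs h1
      omega
    have hgt : g (e t) = e t + 1 := by
      simp only [hg]
      rw [if_pos ((hK t).2 ht.mem), if_pos ht.ne_zero, if_pos hmin]
    obtain ⟨h1, h2⟩ := best_vertex e (g := g) (v := t) (by omega)
    obtain ⟨s, hs⟩ := exists_best_eq_vertex e h1
    obtain ⟨s1, s2, s3, s4⟩ := hgne s (by rw [← hs]; exact h1)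
    have := ht.le s s1 s2
    omega
  refine ⟨fun h => ?_, back t⟩
  obtain ⟨s, hs⟩ := exists_best_eq_vertex e (g := g) (by omega)
  obtain ⟨s1, s2, s3, s4⟩ := hgne s (by rw [← hs]; omega)
  obtain rfl : s = t := (val_eq_iff e).1 (by omega)
  obtain ⟨u, hu⟩ := IsNearest.exists_of_ne_zero K (fun u v => m 9 (e u) (e v))
    (fun v => (e v : ℕ)) s1 s2
  have := back u hu
  obtain rfl : u = s := (val_eq_iff e).1 (by omega)
  exact hu

theorem detourTerm_eval {m : Store} {u v : ℕ} :
    detourTerm.eval n m [u, v] = if m 0 u v ≠ 0 then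
      (if m 6 u 0 + m 6 v 0 ≤ (if m 4 u 0 = m 4 v 0 then 16 else
        m 7 (m 4 u 0 + (m 4 v 0 - m 4 u 0)) 0) then m 6 u 0 + m 6 v 0 + 1 else 1) else 0 := by
  simp only [detourTerm, eval, pick, eval_ifLe, eval_ifEq, List.getD_cons_zero,
    List.getD_cons_succ]

theorem minorTerm_eval {m : Store} {u v : ℕ} :
    minorTerm.eval n m [u, v] = if u = v then 0 else
      if (best n fun x => best n fun y => if m 0 x y ≠ 0 then if m 11 x 0 = u + 1 then
        if m 11 y 0 = v + 1 then 1 else 0 else 0 else 0) ≠ 0 then m 3 u v - 1 else 0 := by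
  simp only [minorTerm, eval, pick, eval_ifEq, List.getD_cons_zero, List.cons_append,
    List.nil_append, List.getD_cons_succ]

theorem best_best_ne_zero_iff (e : V ≃ Fin n) {g : ℕ → ℕ → ℕ} :
    (best n fun x => best n (g x)) ≠ 0 ↔ ∃ x y, g (e x) (e y) ≠ 0 := by
  constructor
  · intro h
    obtain ⟨x, hx⟩ := exists_best_eq_vertex e h
    rw [hx] at h
    obtain ⟨y, hy⟩ := exists_best_eq_vertex e h
    rw [hy] at h
    exact ⟨x, y, h⟩
  · rintro ⟨x, y, h⟩
    exact (best_vertex e (g := fun x => best n (g x)) (v := x) (best_vertex e h).1).1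

/-- The arrays end up holding the distances (`3`), the levels (`4`), `D` (`6`), the cut bounds
(`7`), the codes of the weights (`8`), `ρ` (`9`), its minimum over the terminals (`10`), the cells
(`11`) and the minor (`2`). Each stage needs only that the later ones leave its array unchanged. -/
theorem steiner_spec (e : V ≃ Fin n) {G : SimpleGraph V} (hG : G.IsChordal) (K : Set V) {s : Store}
    (hs : ∀ a, s (phys a) = steiner.func n (fun a => input e G (indicator e K) (phys a)) a) :
    ∃ (M : SimpleGraph K) (w : Sym2 K → ℕ), OutputsGraph e M w s ∧
      G.IsSPRSolution K 4760 M (fun x => (w x : ℝ≥0)) := by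
  classical
  set m₀ : Store := fun a => input e G (indicator e K) (phys a) with hm₀
  have hadj₀ : ∀ u v, m₀ 0 (e u) (e v) = if G.Adj u v then 1 else 0 :=
    input_adj e G (indicator e K)
  have hK₀ : ∀ v, m₀ 1 (e v) 0 ≠ 0 ↔ v ∈ K := fun v => by
    rw [hm₀]
    simp only [input_param]
    exact indicator_ne_zero_iff e
  set m₁ := layers.func n m₀ with hm₁
  obtain ⟨hd, r, hlay⟩ := layers_spec e hadj₀
  rw [← hm₁] at hd hlay
  have k1 : ∀ b, b ≠ 3 → b ≠ 4 → b ≠ 5 → m₁ b = m₀ b := fun b h3 h4 h5 =>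
    layers_func_of_ne h3 h4 h5 _
  have hK₁ : ∀ v, m₁ 1 (e v) 0 ≠ 0 ↔ v ∈ K := by
    rw [k1 1 (by norm_num) (by norm_num) (by norm_num)]
    exact hK₀
  set level : V → ℕ := fun v => m₁ 4 (e v) 0 with hlevel
  have hn : ∀ v : V, 0 < n := fun v => Nat.zero_lt_of_lt (e v).2
  set m₂ := (Routine.tab 6 (nearestTerm 3)).func n m₁ with hm₂
  have k2 : ∀ b, b ≠ 6 → m₂ b = m₁ b := fun b hb => Routine.tab_func_of_ne hb
  set D : V → ℕ := fun v => (nearestTerm 3).eval n m₁ [e v, 0] with hD_def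
  have hD2 : ∀ v, m₂ 6 (e v) 0 = D v := fun v => Routine.tab_func_self (e v).2 (hn v)
  have hD : G.IsTerminalDistCode K D := isTerminalDistCode_of_nearest e hK₁ hd
  set m₃ := twoPartTable.func n m₂ with hm₃
  have k3 : ∀ b, b ≠ 7 → m₃ b = m₂ b := fun b hb => Routine.iterTab_func_of_ne hb
  set m₄ := (Routine.tab 8 detourTerm).func n m₃ with hm₄
  have k4 : ∀ b, b ≠ 8 → m₄ b = m₃ b := fun b hb => Routine.tab_func_of_ne hb
  have hw : ∀ u v, m₄ 8 (e u) (e v) = if G.Adj u v then detour level D u v + 1 else 0 := by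
    intro u v
    have e1 : m₄ 8 (e u) (e v) = detourTerm.eval n m₃ [e u, e v] :=
      Routine.tab_func_self (e u).2 (e v).2
    have e0 : m₃ 0 (e u) (e v) = if G.Adj u v then 1 else 0 := by
      rw [k3 0 (by norm_num), k2 0 (by norm_num), k1 0 (by norm_num) (by norm_num) (by norm_num)]
      exact hadj₀ u v
    have e4 : ∀ v, m₃ 4 (e v) 0 = level v := fun v => by
      rw [k3 4 (by norm_num), k2 4 (by norm_num)]
    have e6 : ∀ v, m₃ 6 (e v) 0 = D v := fun v => by
      rw [k3 6 (by norm_num), hD2]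
    have ecut : (if level u = level v then 16 else m₃ 7 (level u + (level v - level u)) 0) =
        cutBound (level u) (level v) := by
      rw [cutBound]
      split_ifs with heq
      · rfl
      · have l1 := hlay.level_lt e u
        have l2 := hlay.level_lt e v
        -- Truncated subtraction provides the maximum.
        rw [show level u + (level v - level u) = max (level u) (level v) by omega]
        exact twoPartTable_spec (by omega) (by omega)
    rw [e1, detourTerm_eval, e0, e4, e4, e6, e6, ecut, detour]
    by_cases huv : G.Adj u v
    · simp only [huv, if_true]
      split_ifs <;> simp_all
    · simp [huv]
  set m₅ := (distances 8 9).func n m₄ with hm₅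
  have k5 : ∀ b, b ≠ 9 → m₅ b = m₄ b := fun b hb => distances_func_of_ne hb _
  set ρ : V → V → ℕ := fun u v => m₅ 9 (e u) (e v) with hρ_def
  have hρ : G.IsDistCode (detour level D) ρ := distances_spec e (by norm_num) hw
  set m₆ := (Routine.tab 10 (nearestTerm 9)).func n m₅ with hm₆
  have k6 : ∀ b, b ≠ 10 → m₆ b = m₅ b := fun b hb => Routine.tab_func_of_ne hb
  set m₇ := (Routine.tab 11 labelTerm).func n m₆ with hm₇
  have k7 : ∀ b, b ≠ 11 → m₇ b = m₆ b := fun b hb => Routine.tab_func_of_ne hb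
  have hlow : ∀ b, b < 3 → m₆ b = m₀ b := fun b hb => by
    rw [k6 b (by omega), k5 b (by omega), k4 b (by omega), k3 b (by omega), k2 b (by omega),
      k1 b (by omega) (by omega) (by omega)]
  have hlab : ∀ t v, m₇ 11 (e v) 0 = e t + 1 ↔ IsNearest K ρ (fun v => (e v : ℕ)) t v := by
    intro t v
    have e1 : m₇ 11 (e v) 0 = labelTerm.eval n m₆ [e v, 0] := Routine.tab_func_self (e v).2 (hn v)
    rw [e1, labelTerm_eval_eq_iff e (K := K)]
    · rw [hρ_def, k6 9 (by norm_num)]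
    · rw [hlow 1 (by norm_num)]
      exact hK₀
    · intro v
      have e2 : m₆ 10 (e v) 0 = (nearestTerm 9).eval n m₅ [e v, 0] :=
        Routine.tab_func_self (e v).2 (hn v)
      rw [e2, nearestTerm_eval, nearestTerm_eval, k6 1 (by norm_num), k6 9 (by norm_num)]
  have hadj₇ : ∀ u v, m₇ 0 (e u) (e v) ≠ 0 ↔ G.Adj u v := by
    intro u v
    rw [k7 0 (by norm_num), hlow 0 (by norm_num), hadj₀]
    simp
  have hdist₇ : m₇ 3 = m₁ 3 := by
    rw [k7 3 (by norm_num), k6 3 (by norm_num), k5 3 (by norm_num), k4 3 (by norm_num),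
      k3 3 (by norm_num), k2 3 (by norm_num)]
  refine ⟨G.voronoiMinor K ρ fun v => (e v : ℕ), G.distWeight K, fun u v => ?_,
    hlay.isSPRSolution hG hD hρ fun u v huv => (val_eq_iff e).1 huv⟩
  have hout : s 3 (e u) (e v) = minorTerm.eval n m₇ [(e u : ℕ), (e v : ℕ)] := by
    have h2 : s 3 = _ := hs 2
    rw [h2]
    exact Routine.tab_func_self (e u).2 (e v).2
  have hiff : (G.voronoiMinor K ρ fun v => (e v : ℕ)).Adj u v ↔ u ≠ v ∧ ∃ x y, G.Adj x y ∧
      IsNearest K ρ (fun v => (e v : ℕ)) u x ∧ IsNearest K ρ (fun v => (e v : ℕ)) v y := Iff.rfl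
  rw [hout, minorTerm_eval]
  by_cases huv : u = v
  · subst huv
    simp
  · have hne : (e u : ℕ) ≠ e v := fun h => huv (Subtype.ext ((val_eq_iff e).1 h))
    rw [if_neg hne]
    have hcond : ((best n fun x => best n fun y => if m₇ 0 x y ≠ 0 then
        if m₇ 11 x 0 = (e u : ℕ) + 1 then
          if m₇ 11 y 0 = (e v : ℕ) + 1 then 1 else 0 else 0 else 0) ≠ 0) ↔
        (G.voronoiMinor K ρ fun v => (e v : ℕ)).Adj u v := by
      rw [hiff, best_best_ne_zero_iff e]
      simp only [hadj₇, hlab]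
      constructor
      · rintro ⟨x, y, h⟩
        split_ifs at h with h1 h2 h3
        · exact ⟨huv, x, y, h1, h2, h3⟩
        all_goals exact (h rfl).elim
      · rintro ⟨-, x, y, h1, h2, h3⟩
        exact ⟨x, y, by simp [h1, h2, h3]⟩
    by_cases hM : (G.voronoiMinor K ρ fun v => (e v : ℕ)).Adj u v
    · rw [if_pos (hcond.2 hM), if_pos hM, hdist₇]
      obtain ⟨-, x, y, hxy, hx, hy⟩ := hM
      have huv' : G.Reachable (u : V) v := (hρ.ne_zero_iff.1 hx.ne_zero).trans
        (hxy.reachable.trans (hρ.ne_zero_iff.1 hy.ne_zero).symm)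
      have := hd.eq_dist_add_one huv'
      rw [this, Nat.add_sub_cancel]
      rfl
    · rw [if_neg (fun h => hM (hcond.1 h)), if_neg hM]

end steiner

end RAM

theorem mainTheorem7 :
    -- chordal graphs are `(2, 3)`-scatterable, by one polynomial-time algorithm; the parameter is
    -- given to the algorithm rounded down, as all distances are integers
    (∃ (c : RAM.Prog) (p : Polynomial ℕ),
      ∀ (V : Type*) (n : ℕ) (e : V ≃ Fin n) (G : SimpleGraph V), G.IsChordal →
        ∀ Δ : ℝ, 0 < Δ →
          RAM.HaltsWithin c (RAM.input e G (fun i => if i = 0 then ⌊Δ⌋₊ else 0)) (p.eval n)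
            (fun s => G.IsScatteringPartition 2 3 Δ (RAM.outputPartition e s))) ∧
    -- Steiner point removal with constant distortion, by one polynomial-time algorithm
    (∃ (α : ℝ≥0) (c : RAM.Prog) (p : Polynomial ℕ),
      ∀ (V : Type*) (n : ℕ) (e : V ≃ Fin n) (G : SimpleGraph V), G.IsChordal →
        ∀ K : Set V,
          RAM.HaltsWithin c (RAM.input e G (RAM.indicator e K)) (p.eval n)
            (fun s => ∃ (M : SimpleGraph K) (w : Sym2 K → ℕ),
              RAM.OutputsGraph e M w s ∧
                G.IsSPRSolution K α M (fun x => (w x : ℝ≥0)))) :=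
  ⟨⟨RAM.scattering.prog, RAM.scattering.time, fun _ _ e G hG _ hΔ =>
      RAM.scattering.haltsWithin e G _ fun _ hs => RAM.scattering_spec e hG hΔ hs⟩,
    ⟨4760, RAM.steiner.prog, RAM.steiner.time, fun _ _ e G hG K =>
      RAM.steiner.haltsWithin e G _ fun _ hs => RAM.steiner_spec e hG K hs⟩⟩
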